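/- **Setting.** Let $(\mathcal N,\mathcal E)$ be a finite undirected graph, $\mathcal N_i$ the neighbours of node $i$, $\tilde{\mathcal N}_i=\mathcal N_i\cup\{i\}$, $n_i=|\tilde{\mathcal N}_i|$. Node $i$ chooses allocations $\boldsymbol x_i=(x_i(j))_{j\in\tilde{\mathcal N}_i}$ from a closed convex set $\mathcal X_i\subseteq\mathbb R_{+}^{\tilde{\mathcal N}_i}$ that lies in a ball of radius $R_i>0$ and contains a ball of radius $r_i>0$. In round $t$ it has a demand $l_{i,t}\ge l_{\min}>0$ and a random generation $d_{i,t}\ge 0$. For an allocation profile put $$\bar f_{j,t}=\min\Big\{\tfrac{1}{l_{j,t}}\sum_{k\in\tilde{\mathcal N}_j}x_{k}(j),1\Big\},\qquad f_{i,t}=1-\frac1{n_i}\sum_{j\in\tilde{\mathcal N}_i}\bar f_{j,t},\qquad g_{i,t}(\boldsymbol x_i)=\sum_{j\in\tilde{\mathcal N}_i}x_i(j)-d_{i,t}.$$ Assume that on the action sets $|f_{i,t}|\le F_i$ and $|g_{i,t}|\le G_i$, where $F_i,G_i>0$. Let $L=1/l_{\min}$ and $\tilde L_i=3L+LR_i/r_i$.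 For a comparator sequence $\boldsymbol v_{i,1},\dots,\boldsymbol v_{i,T}\in\mathcal X_i$ let $P_T^i=\sum_{t=2}^T\|\boldsymbol v_{i,t}-\boldsymbol v_{i,t-1}\|$. **Algorithm (MA-NSDRS), run by all nodes simultaneously, horizon $T\ge1$.** Node $i$ uses $K=\lceil\frac12\log_2(1+T)\rceil+1$ experts, a learning rate $\epsilon_i$, and $$\eta_{i,t}^k=2^{k-1}\sqrt{\tfrac{2R_i^3}{2|\mathcal N_i|F_i\tilde L_i}}\;t^{-3/4},\quad \delta_{i,t}=\Big(\tfrac{|\mathcal N_i|F_i}{\tilde L_i}\Big)^{1/2}\Big(\tfrac{R_i^2/2+R_ip_i}{t}\Big)^{1/4},\quad \xi_{i,t}=\tfrac{\delta_{i,t}}{r_i},\quad \beta_{i,t}=\tfrac1{G_it^{1/2}},\quad\gamma_{i,t}=\tfrac1{G_i^2t^{1/2}},$$ where $p_i\in[0,P_T^i]$ is any number (for instance $p_i=P^i_T$, or $p_i=0$, in which case the algorithm does not use $P^i_T$ at all). Start with $\boldsymbol z_{i,1}^k=\boldsymbol z_{i,1}\in(1-\xi_{i,1})\mathcal X_i$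 for all $k$, $\omega_{i,1}^k=\frac{K+1}{K}\frac1{k(k+1)}$ and $q_{i,1}=0$. In round $t$: * $\boldsymbol z_{i,t}=\sum_{k=1}^K\omega_{i,t}^k\boldsymbol z_{i,t}^k$ and $\boldsymbol x_{i,t}=\boldsymbol z_{i,t}+\delta_{i,t}\boldsymbol s_{i,t}$ with $\boldsymbol s_{i,t}$ uniform on the unit sphere of $\mathbb R^{\tilde{\mathcal N}_i}$; * the adjusted decision is $\boldsymbol x_{i,t}'=\frac{d_{i,t}}{\sum_jx_{i,t}(j)}\boldsymbol x_{i,t}$ if $\sum_jx_{i,t}(j)>d_{i,t}$, and $\boldsymbol x'_{i,t}=\boldsymbol x_{i,t}$ otherwise; $f_{i,t}(\boldsymbol x)$ denotes the loss of node $i$ when it allocates $\boldsymbol x$ and every other node $k$ plays $\boldsymbol x'_{k,t}$; * with $\hat\nabla f_{i,t}=\frac{n_i}{\delta_{i,t}}f_{i,t}(\boldsymbol x_{i,t})\boldsymbol s_{i,t}$ and $\ell_{i,t}(\boldsymbol z)=\langle\hat\nabla f_{i,t},\boldsymbol z-\boldsymbol z_{i,t}\rangle$, the weights become $\omega_{i,t+1}^k=\dfrac{\omega_{i,t}^ke^{-\epsilon_i\ell_{i,t}(\boldsymbol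 z_{i,t}^k)}}{\sum_{m}\omega_{i,t}^{m}e^{-\epsilon_i\ell_{i,t}(\boldsymbol z_{i,t}^{m})}}$; * $q_{i,t+1}=\max\{0,\;q_{i,t}+\gamma_{i,t+1}(g_{i,t}(\boldsymbol x'_{i,t})-\beta_{i,t+1}q_{i,t})\}$; * $\boldsymbol z_{i,t+1}^k=\mathcal P_{(1-\xi_{i,t+1})\mathcal X_i}\big(\boldsymbol z_{i,t}^k-\eta_{i,t+1}^k\hat{\boldsymbol\Gamma}_{i,t+1}\big)$ with $\hat{\boldsymbol\Gamma}_{i,t+1}=\frac{n_i}{\delta_{i,t}}\big[f_{i,t}(\boldsymbol x_{i,t})\boldsymbol s_{i,t}+q_{i,t+1}\,g_{i,t}(\boldsymbol x_{i,t})\boldsymbol s_{i,t}\big]$, where $\mathcal P$ is Euclidean projection. The directions $\boldsymbol s_{i,t}$ are mutually independent, and independent of the generations and of the starting points. **Theorem.** Let $i$ be a node with at least one neighbour. There are constants $C,a$ and, for every $T\ge1$, a learning rate $\epsilon=\epsilon(T)>0$, all depending only on the graph, the node, the centres and radii of the enclosing balls, and the constants $r_k,F_k,G_k$ ($k\in\mathcal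 N$) and $l_{\min}$, such that the following holds for all action sets, demands and generations as above, all deterministic comparator sequences in the action sets, and all $p_k\in[0,P_T^k]$ ($k\in\mathcal N$). If node $i$ uses $\epsilon_i=\epsilon(T)$ (the other nodes may use any learning rates), then the dynamic regret of node $i$ is integrable and $$\mathbb E\Big[\sum_{t=1}^Tf_{i,t}(\boldsymbol x_{i,t})-\sum_{t=1}^Tf_{i,t}(\boldsymbol v_{i,t})\Big]\le C\,(1+\log T)^a\;T^{3/4}\,(1+P_T^i)^{1/2}.$$ -/

import Mathlib

open scoped Pointwise

noncomputable section

namespace ResourceSharing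

/-! ### The network, allocations, loss and constraint -/

open Classical in
/-- The set `N_i` of neighbours of node `i`. -/
def nbhd {V : Type*} [Fintype V] (Gr : SimpleGraph V) (i : V) : Finset V :=
  Finset.univ.filter fun j => Gr.Adj i j

open Classical in
/-- The set `N_i ∪ {i}`. -/
def closedNbhd {V : Type*} [Fintype V] (Gr : SimpleGraph V) (i : V) : Finset V :=
  Finset.univ.filter fun j => j = i ∨ Gr.Adj i j

/-- Allocation vectors of node `i`: coordinate `j` is the amount sent to `j ∈ N_i ∪ {i}`. -/
abbrev Alloc {V : Type*} [Fintype V] (Gr : SimpleGraph V) (i : V) : Type _ :=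
  EuclideanSpace ℝ (closedNbhd Gr i)

open Classical in
/-- The amount that node `k` sends to node `j` in the allocation profile `y`. -/
def transfer {V : Type*} [Fintype V] {Gr : SimpleGraph V} (y : ∀ k, Alloc Gr k) (k j : V) : ℝ :=
  if h : j ∈ closedNbhd Gr k then y k ⟨j, h⟩ else 0

/-- The satisfaction level `min {(∑ x_k(j)) / l_j, 1}` of node `j` under demands `l`. -/
def satisfaction {V : Type*} [Fintype V] {Gr : SimpleGraph V} (l : V → ℝ)
    (y : ∀ k, Alloc Gr k) (j : V) : ℝ :=
  min ((∑ k ∈ closedNbhd Gr j, transfer y k j) / l j) 1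

/-- The loss of node `i`: one minus the average satisfaction over `N_i ∪ {i}`. -/
def loss {V : Type*} [Fintype V] {Gr : SimpleGraph V} (l : V → ℝ)
    (y : ∀ k, Alloc Gr k) (i : V) : ℝ :=
  1 - (1 / ((closedNbhd Gr i).card : ℝ)) * ∑ j ∈ closedNbhd Gr i, satisfaction l y j

/-- The constraint function: total amount distributed minus the generation `d`. -/
def constr {V : Type*} [Fintype V] {Gr : SimpleGraph V} {i : V} (x : Alloc Gr i) (d : ℝ) : ℝ :=
  (∑ j, x j) - d

/-- The adjustment step: an allocation that exceeds the generation is rescaled to it. -/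
def adjust {V : Type*} [Fintype V] {Gr : SimpleGraph V} {i : V} (x : Alloc Gr i) (d : ℝ) :
    Alloc Gr i :=
  if d < ∑ j, x j then (d / ∑ j, x j) • x else x

/-- A network with its constants: `R k`, `r k` are the radii of the balls around and inside the
action set of node `k` (`center k` is the centre of the outer ball), `F k`, `G k` are the bounds
of its loss and constraint functions, and `minDemand` is a lower bound of all demands. -/
structure Network (V : Type*) [Fintype V] where
  graph : SimpleGraph V
  R : V → ℝ
  r : V → ℝ
  F : V → ℝ
  G : V → ℝ
  minDemand : ℝ
  center : ∀ k, Alloc graph k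
  R_pos : ∀ k, 0 < R k
  r_pos : ∀ k, 0 < r k
  F_pos : ∀ k, 0 < F k
  G_pos : ∀ k, 0 < G k
  minDemand_pos : 0 < minDemand

/-- Action sets and demands on a network. -/
structure Scenario {V : Type*} [Fintype V] (net : Network V) where
  action : ∀ k, Set (Alloc net.graph k)
  demand : V → ℕ → ℝ
  action_closed : ∀ k, IsClosed (action k)
  action_convex : ∀ k, Convex ℝ (action k)
  action_nonneg : ∀ k, ∀ x ∈ action k, ∀ j, 0 ≤ x j
  action_subset : ∀ k, action k ⊆ Metric.closedBall (net.center k) (net.R k)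
  ball_subset : ∀ k, ∃ c, Metric.closedBall c (net.r k) ⊆ action k
  demand_ge : ∀ k t, net.minDemand ≤ demand k t
  loss_bounded : ∀ k t, ∀ y : (∀ j, Alloc net.graph j), (∀ j, y j ∈ action j) →
    |loss (fun j => demand j t) y k| ≤ net.F k

/-! ### Parameters of the algorithm -/

section Parameters

variable {V : Type*} [Fintype V] (net : Network V) (k : V)

/-- The Lipschitz constant `L` of the losses. -/
def Network.lip : ℝ := 1 / net.minDemand

/-- `L̃ = 3 L + L R / r`. -/
def Network.lipTilde : ℝ := 3 * net.lip + net.lip * net.R k / net.r k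

/-- The number of neighbours `|N_k|`. -/
def Network.deg : ℝ := ((nbhd net.graph k).card : ℝ)

/-- The dimension of the allocation vectors of node `k`. -/
def Network.dim : ℝ := ((closedNbhd net.graph k).card : ℝ)

/-- The smoothing radius `δ_{k,t}`, computed with path-length value `p`. -/
def Network.delta (p : ℝ) (t : ℕ) : ℝ :=
  (net.deg k * net.F k / net.lipTilde k) ^ (1 / 2 : ℝ) *
    ((net.R k ^ 2 / 2 + net.R k * p) / (t : ℝ)) ^ (1 / 4 : ℝ)

/-- The shrinkage parameter `ξ_{k,t}`. -/
def Network.xi (p : ℝ) (t : ℕ) : ℝ := net.delta k p t / net.r k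

def Network.beta (t : ℕ) : ℝ := 1 / (net.G k * (t : ℝ) ^ (1 / 2 : ℝ))

def Network.gamma (t : ℕ) : ℝ := 1 / (net.G k ^ 2 * (t : ℝ) ^ (1 / 2 : ℝ))

/-- The step size of expert `m = 1, …, K` of node `k` in round `t`. -/
def Network.eta (m t : ℕ) : ℝ :=
  2 ^ (m - 1) * Real.sqrt (2 * net.R k ^ 3 / (2 * net.deg k * net.F k * net.lipTilde k)) *
    (t : ℝ) ^ (-(3 / 4) : ℝ)

/-- The number of experts `K = ⌈(1/2) log₂ (1 + T)⌉ + 1`. -/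
def numExperts (T : ℕ) : ℕ := ⌈(1 / 2 : ℝ) * Real.logb 2 (1 + (T : ℝ))⌉₊ + 1

/-- The prior weight of expert `m` among `K` experts. -/
def priorWeight (K m : ℕ) : ℝ := ((K : ℝ) + 1) / K * (1 / ((m : ℝ) * ((m : ℝ) + 1)))

end Parameters

/-- Euclidean projection onto `S`: a nearest point of `S` (the only one, when `S` is nonempty,
closed and convex). -/
def proj {E : Type*} [NormedAddCommGroup E] (S : Set E) (x : E) : E :=
  Classical.epsilon fun y => y ∈ S ∧ ∀ w ∈ S, ‖x - y‖ ≤ ‖x - w‖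

/-! ### The algorithm MA-NSDRS, run by all nodes simultaneously -/

/-- What determines one run: horizon, learning rates `ε` of the meta algorithms, values `p` used in
the smoothing radii, generations, sampled directions, starting points. -/
structure RunInput {V : Type*} [Fintype V] (net : Network V) where
  T : ℕ
  ε : V → ℝ
  p : V → ℝ
  gen : V → ℕ → ℝ
  dir : ∀ k, ℕ → Alloc net.graph k
  start : ∀ k, Alloc net.graph k

/-- The memory of a node: iterates and weights of its experts, and its dual variable. -/
structure AgentState (E : Type*) where
  expert : ℕ → E
  weight : ℕ → ℝ
  dual : ℝ

section Algorithm

variable {V : Type*} [Fintype V] {net : Network V} (S : Scenario net) (I : RunInput net)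

/-- The combined point `z_{k,t} = ∑_m ω^m_{k,t} z^m_{k,t}`. -/
def combine (k : V) (s : AgentState (Alloc net.graph k)) : Alloc net.graph k :=
  ∑ m ∈ Finset.Icc 1 (numExperts I.T), s.weight m • s.expert m

/-- The perturbed decision `x_{k,t} = z_{k,t} + δ_{k,t} u_{k,t}`. -/
def perturb (t : ℕ) (k : V) (s : AgentState (Alloc net.graph k)) : Alloc net.graph k :=
  combine I k s + net.delta k (I.p k) t • I.dir k t

open Classical in
/-- The loss function of node `k` in round `t`, as a function of its own allocation `x`, when the
other nodes play their adjusted decisions. -/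
def lossFn (t : ℕ) (s : ∀ k, AgentState (Alloc net.graph k)) (k : V)
    (x : Alloc net.graph k) : ℝ :=
  loss (fun j => S.demand j t)
    (Function.update (fun j => adjust (perturb I t j (s j)) (I.gen j t)) k x) k

/-- One-point estimate `(n / δ_{k,t}) f_{k,t}(x_{k,t}) u_{k,t}` of the gradient of the loss. -/
def gradEst (t : ℕ) (s : ∀ k, AgentState (Alloc net.graph k)) (k : V) : Alloc net.graph k :=
  (net.dim k / net.delta k (I.p k) t * lossFn S I t s k (perturb I t k (s k))) • I.dir k t

/-- The dual variable of round `t + 1`. -/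
def nextDual (t : ℕ) (s : ∀ k, AgentState (Alloc net.graph k)) (k : V) : ℝ :=
  max 0 ((s k).dual + net.gamma k (t + 1) *
    (constr (adjust (perturb I t k (s k)) (I.gen k t)) (I.gen k t)
      - net.beta k (t + 1) * (s k).dual))

/-- The update direction of the experts at the start of round `t + 1`: estimate of the gradient of
the loss plus dual variable times the estimate of the gradient of the constraint function. -/
def updateDir (t : ℕ) (s : ∀ k, AgentState (Alloc net.graph k)) (k : V) : Alloc net.graph k :=
  (net.dim k / net.delta k (I.p k) t) •
    (lossFn S I t s k (perturb I t k (s k)) • I.dir k t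
      + (nextDual I t s k * constr (perturb I t k (s k)) (I.gen k t)) • I.dir k t)

/-- The surrogate loss of round `t`. -/
def surrogate (t : ℕ) (s : ∀ k, AgentState (Alloc net.graph k)) (k : V)
    (z : Alloc net.graph k) : ℝ :=
  inner ℝ (gradEst S I t s k) (z - combine I k (s k))

/-- From the memory in round `t` to the memory in round `t + 1`. -/
def nextState (t : ℕ) (s : ∀ k, AgentState (Alloc net.graph k)) (k : V) :
    AgentState (Alloc net.graph k) where
  expert m := proj ((1 - net.xi k (I.p k) (t + 1)) • S.action k)
    ((s k).expert m - net.eta k m (t + 1) • updateDir S I t s k)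
  weight m := (s k).weight m * Real.exp (-I.ε k * surrogate S I t s k ((s k).expert m)) /
    ∑ m' ∈ Finset.Icc 1 (numExperts I.T),
      (s k).weight m' * Real.exp (-I.ε k * surrogate S I t s k ((s k).expert m'))
  dual := nextDual I t s k

/-- The memory in the first round. -/
def firstState (k : V) : AgentState (Alloc net.graph k) where
  expert _ := I.start k
  weight m := priorWeight (numExperts I.T) m
  dual := 0

/-- The memory of all nodes in round `t = 1, 2, …` (the value at `t = 0` is not used). -/
def state : ℕ → ∀ k, AgentState (Alloc net.graph k)
  | 0 => firstState I
  | 1 => firstState I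
  | t + 2 => nextState S I (t + 1) (state (t + 1))

/-- The decision `x_{k,t}`. -/
def decision (k : V) (t : ℕ) : Alloc net.graph k := perturb I t k (state S I t k)

/-- The loss function `f_{k,t}` along the run. -/
def roundLoss (k : V) (t : ℕ) (x : Alloc net.graph k) : ℝ := lossFn S I t (state S I t) k x

/-- The dynamic regret of node `k` in the run, against the comparators `v 1, …, v T`. -/
def dynRegret (k : V) (v : ℕ → Alloc net.graph k) : ℝ :=
  ∑ t ∈ Finset.Icc 1 I.T, roundLoss S I k t (decision S I k t)
    - ∑ t ∈ Finset.Icc 1 I.T, roundLoss S I k t (v t)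

end Algorithm

/-- The path length `P_T = ∑_{t=2}^T ‖v_t - v_{t-1}‖`. -/
def pathLength {E : Type*} [NormedAddCommGroup E] (T : ℕ) (v : ℕ → E) : ℝ :=
  ∑ t ∈ Finset.Icc 2 T, ‖v t - v (t - 1)‖

/-- The uniform distribution on the unit sphere of the allocation space of node `k`. -/
def sphereUniform {V : Type*} [Fintype V] (Gr : SimpleGraph V) (k : V) :
    MeasureTheory.Measure (Metric.sphere (0 : Alloc Gr k) 1) :=
  let σ := (MeasureTheory.volume : MeasureTheory.Measure (Alloc Gr k)).toSphere
  (σ Set.univ)⁻¹ • σ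

end ResourceSharing

end

/-! Along a run the constraint has no effect. The adjusted decision always satisfies it, so the dual
variable starts at 0 and is never pushed above 0 (`state_dual`). Each expert therefore performs
projected gradient descent on the one-point estimate of the loss gradient alone.

As a function of its own allocation, the loss of a node is 1 plus a sum of convex functions of
single coordinates, because the amount sent to `j` enters only the satisfaction of `j`
(`exists_separable_loss`). This makes the usual smoothing and divergence-theorem argument
unnecessary. Reflections of the sphere isolate one coordinate, `n E[u_k²] = 1` normalises it, and
monotone slopes of convex functions show that the averaged estimate is a subgradient up to `O(δ)`
(`SphereInvariant.one_point_estimate`). Conditioning on the past is replaced by Fubini: one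
direction is independent of all other randomness, and the state of round `t` does not involve it
(`expectation_subgradientGap_le`).

Decisions need not lie in the action sets; the factor `1 - ξ` may even be negative. The losses are
therefore controlled on the whole space, where they are nonnegative and grow linearly. Since `p ≤
P_T ≤ 2RT`, the iterates of round `t` have norm `O((T/t)^(1/4))`. As `δ_t` is of order `t^(-1/4)`,
the gradient estimates are `O(T^(1/4))` uniformly in `t`.

Along each run (`dynRegret_le`) the regret splits into the Lipschitz cost of perturbing and
shrinking, the gap of the gradient estimates, the regret against one expert, and the regret of that
expert. The first is at most a multiple of `∑ δ_t = O(T^(3/4) √(1+P))`, and the expected gap obeys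
the same bound. Gradient descent with steps `b t^(-3/4)` has regret `O(T^(3/4) ((1+P)/b + b))`
(`online_gradient_descent_regret`), and some expert has `b` within a constant factor of `√(1+P)`
(`exists_expert`). Exponential weights with rate `T^(-3/4)` cost `O(T^(3/4) (1 + log T))`
(`meta_regret_le`). -/

namespace ResourceSharing

open MeasureTheory ProbabilityTheory

/-! ### Invariance of the surface measure under linear isometries. -/

section SphereSymmetry

variable {E : Type*} [NormedAddCommGroup E] [InnerProductSpace ℝ E]

/-- The action of a linear isometry on the unit sphere. -/
def sphereMap (e : E ≃ₗᵢ[ℝ] E) (x : Metric.sphere (0 : E) 1) : Metric.sphere (0 : E) 1 :=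
  ⟨e x, by simp⟩

theorem continuous_sphereMap (e : E ≃ₗᵢ[ℝ] E) : Continuous (sphereMap e) :=
  Continuous.subtype_mk (e.continuous.comp continuous_subtype_val) _

variable [MeasurableSpace E] [BorelSpace E]

/-- The surface measure of a set is a multiple of the volume of the cone over it. A linear isometry
carries cones to cones and preserves volume. -/
theorem map_sphereMap_toSphere [FiniteDimensional ℝ E] (e : E ≃ₗᵢ[ℝ] E) :
    (volume : Measure E).toSphere.map (sphereMap e) = (volume : Measure E).toSphere := by
  ext s hs
  have hm : Measurable (sphereMap e) := (continuous_sphereMap e).measurable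
  rw [Measure.map_apply hm hs, Measure.toSphere_apply' _ hs, Measure.toSphere_apply' _ (hm hs)]
  congr 1
  have : Set.Ioo (0 : ℝ) 1 • ((↑) '' (sphereMap e ⁻¹' s) : Set E)
      = e.toMeasurableEquiv ⁻¹' (Set.Ioo (0 : ℝ) 1 • ((↑) '' s)) := by
    ext x
    simp only [Set.mem_smul, Set.mem_image, Set.mem_preimage]
    constructor
    · rintro ⟨r, hr, _, ⟨y, hy, rfl⟩, rfl⟩
      exact ⟨r, hr, _, ⟨_, hy, rfl⟩, by simp [sphereMap]⟩
    · rintro ⟨r, hr, _, ⟨y, hy, rfl⟩, h⟩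
      refine ⟨r, hr, _, ⟨sphereMap e.symm y, ?_, rfl⟩, ?_⟩
      · simpa [sphereMap] using hy
      · apply e.injective
        simpa [sphereMap] using h
  rw [this]
  exact MeasurePreserving.measure_preimage_equiv (f := e.toMeasurableEquiv) e.measurePreserving _

/-- A measure on the unit sphere invariant under linear isometries. -/
def SphereInvariant (σ : Measure (Metric.sphere (0 : E) 1)) : Prop :=
  ∀ e : E ≃ₗᵢ[ℝ] E, σ.map (sphereMap e) = σ

theorem SphereInvariant.integral_comp {σ : Measure (Metric.sphere (0 : E) 1)}
    (hσ : SphereInvariant σ) (e : E ≃ₗᵢ[ℝ] E) {g : E → ℝ} (hg : Continuous g) :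
    ∫ u, g (e u) ∂σ = ∫ u, g (u : E) ∂σ := by
  conv_rhs => rw [← hσ e]
  exact (integral_map (continuous_sphereMap e).measurable.aemeasurable
    (hg.comp continuous_subtype_val).aestronglyMeasurable (f := fun u => g (u : E))).symm

end SphereSymmetry

/-! ### One-point gradient estimates for separable convex functions. -/

section OnePoint

theorem integrable_sphere {E : Type*} [NormedAddCommGroup E] [InnerProductSpace ℝ E]
    [FiniteDimensional ℝ E] [MeasurableSpace E] [BorelSpace E]
    (σ : Measure (Metric.sphere (0 : E) 1)) [IsFiniteMeasure σ] {g : E → ℝ} (hg : Continuous g) :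
    Integrable (fun u : Metric.sphere (0 : E) 1 => g u) σ :=
  (hg.comp continuous_subtype_val).integrable_of_hasCompactSupport
    (HasCompactSupport.of_compactSpace _)

variable {ι : Type*} [Fintype ι]
  {σ : Measure (Metric.sphere (0 : EuclideanSpace ℝ ι) 1)}

open Classical in
/-- The reflection that changes the sign of coordinate `k`. -/
noncomputable def coordFlip (k : ι) : EuclideanSpace ℝ ι ≃ₗᵢ[ℝ] EuclideanSpace ℝ ι :=
  LinearIsometryEquiv.piLpCongrRight 2
    (fun j => if j = k then LinearIsometryEquiv.neg ℝ else LinearIsometryEquiv.refl ℝ ℝ)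

theorem coordFlip_same (k : ι) (x : EuclideanSpace ℝ ι) : coordFlip k x k = - x k := by
  simp [coordFlip]

theorem coordFlip_ne {j k : ι} (h : j ≠ k) (x : EuclideanSpace ℝ ι) : coordFlip k x j = x j := by
  simp [coordFlip, h]

/-- The integrand is odd under the reflection in coordinate `k`. This removes all summands of a
separable function except the `k`-th. -/
theorem SphereInvariant.integral_mul_coord_eq_zero (hσ : SphereInvariant σ) {j k : ι} (h : j ≠ k)
    {φ : ℝ → ℝ} (hφ : Continuous φ) :
    ∫ u : Metric.sphere (0 : EuclideanSpace ℝ ι) 1,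
      φ ((u : EuclideanSpace ℝ ι) j) * (u : EuclideanSpace ℝ ι) k ∂σ = 0 := by
  have := hσ.integral_comp (coordFlip k) (g := fun x => φ (x j) * x k) (by fun_prop)
  simp only [coordFlip_same, coordFlip_ne h, mul_neg, integral_neg] at this
  linarith

theorem SphereInvariant.integral_coord_eq_zero (hσ : SphereInvariant σ) (k : ι) :
    ∫ u : Metric.sphere (0 : EuclideanSpace ℝ ι) 1, (u : EuclideanSpace ℝ ι) k ∂σ = 0 := by
  have := hσ.integral_comp (coordFlip k) (g := fun x => x k) (by fun_prop)
  simp only [coordFlip_same, integral_neg] at this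
  linarith

/-- Swapping coordinates shows that all second moments agree, and they add up to the integral of
`‖u‖² = 1`. -/
theorem SphereInvariant.card_mul_integral_sq (hσ : SphereInvariant σ) [IsProbabilityMeasure σ]
    (k : ι) :
    (Fintype.card ι : ℝ) * ∫ u : Metric.sphere (0 : EuclideanSpace ℝ ι) 1,
      (u : EuclideanSpace ℝ ι) k ^ 2 ∂σ = 1 := by
  classical
  have hj : ∀ j, ∫ u : Metric.sphere (0 : EuclideanSpace ℝ ι) 1,
      (u : EuclideanSpace ℝ ι) j ^ 2 ∂σ = ∫ u : Metric.sphere (0 : EuclideanSpace ℝ ι) 1,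
      (u : EuclideanSpace ℝ ι) k ^ 2 ∂σ := by
    intro j
    have := hσ.integral_comp (LinearIsometryEquiv.piLpCongrLeft 2 ℝ ℝ (Equiv.swap j k))
      (g := fun x => x k ^ 2) (by fun_prop)
    rw [← this]
    congr 1
    ext u
    simp [LinearIsometryEquiv.piLpCongrLeft_apply, Equiv.piCongrLeft']
  have hsum : ∑ j, ∫ u : Metric.sphere (0 : EuclideanSpace ℝ ι) 1,
      (u : EuclideanSpace ℝ ι) j ^ 2 ∂σ = 1 := by
    rw [← integral_finsetSum]
    · have : ∀ u : Metric.sphere (0 : EuclideanSpace ℝ ι) 1,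
          ∑ j, (u : EuclideanSpace ℝ ι) j ^ 2 = 1 := by
        intro u
        rw [← EuclideanSpace.real_norm_sq_eq]
        simp
      simp [this]
    · intro j _
      exact integrable_sphere σ (g := fun x => x j ^ 2) (by fun_prop)
  rw [Finset.sum_congr rfl fun j _ => hj j] at hsum
  simpa using hsum

/-- Three-slope inequality of a convex Lipschitz function, in product form. -/
theorem convex_slope_mul_le {φ : ℝ → ℝ} (hφ : ConvexOn ℝ Set.univ φ) {Λ : ℝ}
    (hL : ∀ x y, |φ x - φ y| ≤ Λ * |x - y|) (z y h : ℝ) :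
    (φ (z + y) - φ z) * y * h ≤ y ^ 2 * (φ (z + h) - φ z + 2 * Λ * |y|) := by
  have hΛ : 0 ≤ Λ := by
    have := (abs_nonneg _).trans (hL 1 0)
    simpa using this
  have h1 := hL (z + y) z
  have h2 := hL (z + h) z
  simp only [add_sub_cancel_left] at h1 h2
  -- When `h` is the shorter increment, the Lipschitz bound alone suffices and uses up the error
  -- `2Λ|y|`. Otherwise monotonicity of slopes gives the inequality without any error.
  by_cases hle : |h| ≤ |y|
  · have e1 : (φ (z + y) - φ z) * y * h ≤ Λ * |y| * |y| * |y| := by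
      refine (le_abs_self _).trans ?_
      rw [abs_mul, abs_mul]
      gcongr
    have e2 : -(Λ * |y|) ≤ φ (z + h) - φ z := by
      have := neg_abs_le (φ (z + h) - φ z)
      have : Λ * |h| ≤ Λ * |y| := by gcongr
      linarith
    rw [← sq_abs y]
    nlinarith [mul_nonneg (sq_nonneg |y|) (by linarith : 0 ≤ φ (z + h) - φ z + Λ * |y|)]
  · push Not at hle
    have hh : 0 < |h| := (abs_nonneg y).trans_lt hle
    have hh0 : h ≠ 0 := abs_pos.mp hh
    have key : (φ (z + y) - φ z) * y * h ≤ y ^ 2 * (φ (z + h) - φ z) := by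
      by_cases hs : 0 ≤ y * h
      · -- `z + y` lies between `z` and `z + h`
        have hl0 : 0 ≤ y / h := by
          rw [div_eq_mul_inv, ← mul_self_mul_inv h⁻¹, inv_inv]
          nlinarith [mul_nonneg hs (mul_self_nonneg h⁻¹)]
        have hl1 : y / h ≤ 1 := by
          refine (le_abs_self _).trans ?_
          rw [abs_div, div_le_one hh]; exact hle.le
        have hc := hφ.2 (Set.mem_univ z) (Set.mem_univ (z + h)) (sub_nonneg.mpr hl1) hl0 (by ring)
        have e : (1 - y / h) • z + (y / h) • (z + h) = z + y := by
          simp only [smul_eq_mul]; field_simp; ring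
        rw [e] at hc
        simp only [smul_eq_mul] at hc
        have : φ (z + y) - φ z ≤ y / h * (φ (z + h) - φ z) := by linarith
        calc (φ (z + y) - φ z) * y * h = (φ (z + y) - φ z) * (y * h) := by ring
          _ ≤ (y / h * (φ (z + h) - φ z)) * (y * h) := by gcongr
          _ = y ^ 2 * (φ (z + h) - φ z) := by field_simp
      · push Not at hs
        have hy0 : y ≠ 0 := by rintro rfl; simp at hs
        have hd : h - y ≠ 0 := by
          intro h0; have : h = y := by linarith
          subst this; nlinarith [mul_self_nonneg h]
        -- `z` lies between `z + y` and `z + h`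
        have ha : 0 ≤ h / (h - y) := by
          rw [div_eq_mul_inv, show h * (h - y)⁻¹ = (h * (h - y)) * ((h - y)⁻¹ * (h - y)⁻¹) by
            field_simp]
          exact mul_nonneg (by nlinarith [mul_self_nonneg h]) (mul_self_nonneg _)
        have hb : 0 ≤ -y / (h - y) := by
          rw [div_eq_mul_inv, show -y * (h - y)⁻¹ = (-y * (h - y)) * ((h - y)⁻¹ * (h - y)⁻¹) by
            field_simp]
          exact mul_nonneg (by nlinarith [mul_self_nonneg y]) (mul_self_nonneg _)
        have hc := hφ.2 (Set.mem_univ (z + y)) (Set.mem_univ (z + h)) ha hb (by field_simp; ring)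
        have e : (h / (h - y)) • (z + y) + (-y / (h - y)) • (z + h) = z := by
          simp only [smul_eq_mul]; field_simp; ring
        rw [e] at hc
        simp only [smul_eq_mul] at hc
        have h3 : 0 ≤ h / (h - y) * (φ (z + y) - φ z) + -y / (h - y) * (φ (z + h) - φ z) := by
          have : h / (h - y) + -y / (h - y) = 1 := by field_simp; ring
          nlinarith [congrArg (· * φ z) this]
        have h4 : 0 ≤ (-y * (h - y)) := by nlinarith [mul_self_nonneg y]
        have h5 := mul_nonneg h3 h4
        have h6 : (h / (h - y) * (φ (z + y) - φ z) + -y / (h - y) * (φ (z + h) - φ z)) *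
            (-y * (h - y)) = -(y * h) * (φ (z + y) - φ z) + y ^ 2 * (φ (z + h) - φ z) := by
          field_simp; ring
        rw [h6] at h5
        linarith
    have : 0 ≤ y ^ 2 * (2 * Λ * |y|) := by positivity
    linarith

theorem continuous_of_abs_sub_le {φ : ℝ → ℝ} {Λ : ℝ} (hL : ∀ x y, |φ x - φ y| ≤ Λ * |x - y|) :
    Continuous φ :=
  (LipschitzWith.of_dist_le' (K := Λ) fun x y => by simpa [Real.dist_eq] using hL x y).continuous

/-- The one-point gradient estimate of a separable convex Lipschitz function, averaged over the
sphere, is a subgradient up to an error proportional to the smoothing radius. -/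
theorem SphereInvariant.one_point_estimate (hσ : SphereInvariant σ) [IsProbabilityMeasure σ]
    {φ : ι → ℝ → ℝ} (hφ : ∀ j, ConvexOn ℝ Set.univ (φ j)) {Λ : ℝ}
    (hL : ∀ j x y, |φ j x - φ j y| ≤ Λ * |x - y|) {f : EuclideanSpace ℝ ι → ℝ} {a : ℝ}
    (hf : ∀ x, f x = a + ∑ j, φ j (x j)) {δ : ℝ} (hδ : 0 < δ) (z w : EuclideanSpace ℝ ι) :
    ∫ u : Metric.sphere (0 : EuclideanSpace ℝ ι) 1, (f z - f w -
      inner ℝ (((Fintype.card ι : ℝ) / δ * f (z + δ • (u : EuclideanSpace ℝ ι))) •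
        (u : EuclideanSpace ℝ ι)) (z - w)) ∂σ ≤ (Fintype.card ι : ℝ) * (2 * Λ * δ) := by
  set n : ℝ := ((Fintype.card ι : ℕ) : ℝ) with hn
  have hφc : ∀ j, Continuous (φ j) := fun j => continuous_of_abs_sub_le (hL j)
  have hfc : Continuous f := by
    rw [funext hf]
    fun_prop
  -- Only the `k`-th summand correlates with `u_k`. Since `u_k` has mean zero, the constant `φ k (z
  -- k)` may be subtracted, which produces an increment.
  have hcoord : ∀ k, ∫ u : Metric.sphere (0 : EuclideanSpace ℝ ι) 1,
      f (z + δ • (u : EuclideanSpace ℝ ι)) * (u : EuclideanSpace ℝ ι) k ∂σ =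
      ∫ u : Metric.sphere (0 : EuclideanSpace ℝ ι) 1,
        (φ k (z k + δ * (u : EuclideanSpace ℝ ι) k) - φ k (z k)) *
          (u : EuclideanSpace ℝ ι) k ∂σ := by
    intro k
    have e1 : ∀ u : EuclideanSpace ℝ ι, f (z + δ • u) * u k =
        a * u k + ∑ j, φ j (z j + δ * u j) * u k := by
      intro u; rw [hf]; simp [add_mul, Finset.sum_mul]
    have e2 : ∀ u : EuclideanSpace ℝ ι, (φ k (z k + δ * u k) - φ k (z k)) * u k =
        φ k (z k + δ * u k) * u k - φ k (z k) * u k := by intro u; ring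
    simp only [e1, e2]
    rw [integral_add (integrable_sphere σ (g := fun u => a * u k) (by fun_prop))
      (integrable_sphere σ (g := fun u => ∑ j, φ j (z j + δ * u j) * u k) (by fun_prop)),
      integral_finsetSum _ (fun j _ =>
        integrable_sphere σ (g := fun u => φ j (z j + δ * u j) * u k) (by fun_prop)),
      integral_sub (integrable_sphere σ (g := fun u => φ k (z k + δ * u k) * u k) (by fun_prop))
      (integrable_sphere σ (g := fun u => φ k (z k) * u k) (by fun_prop)),
      integral_const_mul, integral_const_mul, hσ.integral_coord_eq_zero k, mul_zero, mul_zero,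
      zero_add, sub_zero]
    rw [Finset.sum_eq_single k]
    · intro j _ hj
      exact hσ.integral_mul_coord_eq_zero hj (φ := fun x => φ j (z j + δ * x)) (by fun_prop)
    · simp
  -- The slope inequality is applied with `y = δ u_k` and `h = w_k - z_k`. Its product form avoids
  -- division by `u_k` and leaves a multiple of `u_k²`, whose mean is `1/n`.
  have hterm : ∀ k, -(n / δ * (z k - w k)) * ∫ u : Metric.sphere (0 : EuclideanSpace ℝ ι) 1,
        (φ k (z k + δ * (u : EuclideanSpace ℝ ι) k) - φ k (z k)) *
          (u : EuclideanSpace ℝ ι) k ∂σ ≤ φ k (w k) - φ k (z k) + 2 * Λ * δ := by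
    intro k
    rw [← integral_const_mul]
    calc _ ≤ ∫ u : Metric.sphere (0 : EuclideanSpace ℝ ι) 1,
          (n * (φ k (w k) - φ k (z k) + 2 * Λ * δ)) * (u : EuclideanSpace ℝ ι) k ^ 2 ∂σ := by
          refine integral_mono
            (integrable_sphere σ (g := fun u => -(n / δ * (z k - w k)) *
              ((φ k (z k + δ * u k) - φ k (z k)) * u k)) (by fun_prop))
            (integrable_sphere σ (g := fun u =>
              (n * (φ k (w k) - φ k (z k) + 2 * Λ * δ)) * u k ^ 2) (by fun_prop)) ?_
          intro u
          set s := (u : EuclideanSpace ℝ ι) k with hs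
          have hs1 : |s| ≤ 1 := by
            have := PiLp.norm_apply_le (u : EuclideanSpace ℝ ι) k
            simpa [hs] using this
          have hΛ : 0 ≤ Λ := by
            have := (abs_nonneg _).trans (hL k 1 0)
            simpa using this
          have h1 := convex_slope_mul_le (hφ k) (hL k) (z k) (δ * s) (w k - z k)
          rw [add_sub_cancel, abs_mul, abs_of_pos hδ] at h1
          have h2 : (δ * s) ^ 2 * (φ k (w k) - φ k (z k) + 2 * Λ * (δ * |s|)) ≤
              (δ * s) ^ 2 * (φ k (w k) - φ k (z k) + 2 * Λ * δ) := by
            gcongr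
            nlinarith
          have h3 := h1.trans h2
          have h4 : 0 ≤ n / δ ^ 2 := by positivity
          have h5 := mul_le_mul_of_nonneg_left h3 h4
          simp only
          rw [← hs]
          convert h5 using 1 <;> · field_simp; try ring
      _ = φ k (w k) - φ k (z k) + 2 * Λ * δ := by
          rw [integral_const_mul, mul_right_comm, hn, hσ.card_mul_integral_sq k, one_mul]
  have hexp : ∀ u : EuclideanSpace ℝ ι,
      inner ℝ ((n / δ * f (z + δ • u)) • u) (z - w) =
        ∑ k, (n / δ * (z k - w k)) * (f (z + δ • u) * u k) := by
    intro u
    rw [PiLp.inner_apply]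
    refine Finset.sum_congr rfl fun k _ => ?_
    simp
    ring
  have hint : Integrable (fun u : Metric.sphere (0 : EuclideanSpace ℝ ι) 1 =>
      inner ℝ ((n / δ * f (z + δ • (u : EuclideanSpace ℝ ι))) • (u : EuclideanSpace ℝ ι))
        (z - w)) σ :=
    integrable_sphere σ (g := fun u => inner ℝ ((n / δ * f (z + δ • u)) • u) (z - w))
      (by fun_prop)
  rw [integral_sub (integrable_const _) hint, integral_const]
  simp only [probReal_univ, one_smul, hexp]
  rw [integral_finsetSum _ (fun k _ => integrable_sphere σ
    (g := fun u => (n / δ * (z k - w k)) * (f (z + δ • u) * u k)) (by fun_prop))]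
  simp only [integral_const_mul, hcoord]
  have := Finset.sum_le_sum fun k (_ : k ∈ Finset.univ) => hterm k
  rw [Finset.sum_add_distrib, Finset.sum_sub_distrib] at this
  simp only [neg_mul, Finset.sum_neg_distrib, Finset.sum_const, Finset.card_univ,
    nsmul_eq_mul] at this
  rw [hf z, hf w]
  linarith

end OnePoint

/-! ### Independence of one direction from the rest, and Fubini. -/

section Independence

/-- One member of an independent family is independent of the other members together with any
randomness that is independent of the whole family. -/
theorem indepFun_update_prod {Ω I D : Type*} [MeasurableSpace Ω] {P : Measure Ω}
    [IsProbabilityMeasure P] [DecidableEq I] {X : I → Type*} [∀ a, MeasurableSpace (X a)]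
    [MeasurableSpace D] {U : ∀ a, Ω → X a} {Z : Ω → D} (hU : ∀ a, Measurable (U a))
    (hZ : Measurable Z) (hind : iIndepFun U P) (hUZ : IndepFun (fun ω a => U a ω) Z P)
    (b : I) (x₀ : X b) :
    IndepFun (U b) (fun ω => (Function.update (fun a => U a ω) b x₀, Z ω)) P := by
  -- Coordinate `b` is overwritten by a constant rather than dropped, so that the remaining
  -- randomness keeps the type of a full family.
  set W : Ω → ∀ a, X a := fun ω => Function.update (fun a => U a ω) b x₀ with hW
  have hall : Measurable (fun ω a => U a ω) := measurable_pi_lambda _ hU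
  have hupd : Measurable (fun y : ∀ a, X a => Function.update y b x₀) :=
    measurable_update_left
  have hWm : Measurable W := hupd.comp hall
  have h1 : IndepFun (U b) W P := by
    have h := indep_iSup_of_disjoint (m := fun a => MeasurableSpace.comap (U a) inferInstance)
      (fun a => (hU a).comap_le) hind.iIndep (S := {b}) (T := {b}ᶜ) (by simp)
    refine indep_of_indep_of_le_left (indep_of_indep_of_le_right h ?_) ?_
    · rw [← measurable_iff_comap_le]
      refine @measurable_pi_lambda _ _ _ (_) _ _ fun a => ?_
      by_cases ha : a = b
      · subst ha
        simp only [hW, Function.update_self]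
        exact measurable_const
      · simp only [hW, Function.update_of_ne ha]
        rw [measurable_iff_comap_le]
        exact le_iSup₂_of_le a (by simpa using ha) le_rfl
    · simp
  have h2 : IndepFun (fun ω => (U b ω, W ω)) Z P :=
    hUZ.comp (φ := fun y => (y b, Function.update y b x₀))
      ((measurable_pi_apply b).prodMk hupd) measurable_id
  have h3 : IndepFun W Z P := hUZ.comp hupd measurable_id
  rw [indepFun_iff_map_prod_eq_prod_map_map (hU b).aemeasurable (hWm.prodMk hZ).aemeasurable]
  rw [indepFun_iff_map_prod_eq_prod_map_map (by fun_prop) (by fun_prop)] at h1 h2 h3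
  have : IsProbabilityMeasure (P.map (U b)) := Measure.isProbabilityMeasure_map (by fun_prop)
  have : IsProbabilityMeasure (P.map W) := Measure.isProbabilityMeasure_map (by fun_prop)
  have : IsProbabilityMeasure (P.map Z) := Measure.isProbabilityMeasure_map (by fun_prop)
  -- The joint law of `(U b, W)` and `Z` is a product, and so is that of `U b` and `W`.
  -- Reassociating the triple product separates `U b` from the pair `(W, Z)`.
  rw [h3, ← Measure.prodAssoc_prod, ← h1, ← h2, Measure.map_map (by fun_prop) (by fun_prop)]
  rfl

/-- This plays the role of conditioning on `Y`: under the product law the integral over `X` can be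
taken first, with `Y` frozen. -/
theorem IndepFun.integral_le_of_forall_integral_le {Ω A B : Type*} [MeasurableSpace Ω]
    {P : Measure Ω} [IsProbabilityMeasure P] [MeasurableSpace A] [MeasurableSpace B]
    {X : Ω → A} {Y : Ω → B} (hX : Measurable X) (hY : Measurable Y) (hXY : IndepFun X Y P)
    {h : A × B → ℝ} (hm : Measurable h) (hint : Integrable (fun ω => h (X ω, Y ω)) P) {c : ℝ}
    (hc : ∀ ω, ∫ x, h (x, Y ω) ∂(P.map X) ≤ c) :
    ∫ ω, h (X ω, Y ω) ∂P ≤ c := by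
  have hXY' : Measurable fun ω => (X ω, Y ω) := hX.prodMk hY
  have : IsProbabilityMeasure (P.map X) := Measure.isProbabilityMeasure_map (by fun_prop)
  have : IsProbabilityMeasure (P.map Y) := Measure.isProbabilityMeasure_map (by fun_prop)
  rw [indepFun_iff_map_prod_eq_prod_map_map (by fun_prop) (by fun_prop)] at hXY
  have hi : Integrable h ((P.map X).prod (P.map Y)) := by
    rw [← hXY, integrable_map_measure hm.aestronglyMeasurable hXY'.aemeasurable]
    exact hint
  have e : ∫ ω, h (X ω, Y ω) ∂P = ∫ ω, ∫ x, h (x, Y ω) ∂(P.map X) ∂P := by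
    rw [← integral_map hXY'.aemeasurable hm.aestronglyMeasurable, hXY, integral_prod_symm _ hi,
      integral_map hY.aemeasurable hi.integral_prod_right.aestronglyMeasurable]
  have hi2 : Integrable (fun ω => ∫ x, h (x, Y ω) ∂(P.map X)) P := by
    have := hi.integral_prod_right
    rwa [integrable_map_measure this.aestronglyMeasurable hY.aemeasurable] at this
  rw [e]
  calc _ ≤ ∫ _, c ∂P := integral_mono hi2 (integrable_const _) hc
    _ = c := by simp

end Independence

/-! ### Elementary estimates for fourth roots. -/

section Quartic

/-- The fourth root of a natural number. -/
noncomputable def quart (t : ℕ) : ℝ := (t : ℝ) ^ (1 / 4 : ℝ)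

theorem quart_pow_four (t : ℕ) : quart t ^ 4 = t := by
  rw [quart, ← Real.rpow_natCast, ← Real.rpow_mul (by positivity)]
  norm_num

theorem quart_nonneg (t : ℕ) : 0 ≤ quart t := by unfold quart; positivity

theorem one_le_quart {t : ℕ} (ht : 1 ≤ t) : 1 ≤ quart t :=
  Real.one_le_rpow (by exact_mod_cast ht) (by norm_num)

theorem quart_pos {t : ℕ} (ht : 1 ≤ t) : 0 < quart t := one_pos.trans_le (one_le_quart ht)

theorem quart_one : quart 1 = 1 := by simp [quart]

theorem quart_mono {s t : ℕ} (h : s ≤ t) : quart s ≤ quart t :=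
  Real.rpow_le_rpow (by positivity) (by exact_mod_cast h) (by norm_num)

theorem rpow_three_quarters (t : ℕ) : (t : ℝ) ^ (3 / 4 : ℝ) = quart t ^ 3 := by
  rw [quart, ← Real.rpow_natCast, ← Real.rpow_mul (by positivity)]
  norm_num

theorem rpow_neg_three_quarters (t : ℕ) : (t : ℝ) ^ (-(3 / 4) : ℝ) = 1 / quart t ^ 3 := by
  rw [Real.rpow_neg (by positivity), rpow_three_quarters, one_div]

theorem quart_succ_pow_four (t : ℕ) : quart (t + 1) ^ 4 = quart t ^ 4 + 1 := by
  simp [quart_pow_four]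

theorem quart_succ_cube_sub_le {t : ℕ} (ht : 1 ≤ t) :
    quart (t + 1) ^ 3 - quart t ^ 3 ≤ 1 / quart t := by
  have hb := quart_pos ht
  have hab := quart_mono (Nat.le_succ t)
  have h := quart_succ_pow_four t
  rw [le_div_iff₀ hb]
  nlinarith [mul_le_mul_of_nonneg_left hab (pow_nonneg (quart_nonneg (t + 1)) 3)]

/-- With `b = quart t` and `a = quart (t + 1)`, one has `1/a = a³/(b⁴+1) ≥ b³/(b⁴+1)`, and this is
at least `1/b - 1/b⁵`. It controls the drift of the shrinkage parameter. -/
theorem inv_quart_sub_le {t : ℕ} (ht : 1 ≤ t) :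
    1 / quart t - 1 / quart (t + 1) ≤ 1 / quart t ^ 5 := by
  have hb := quart_pos ht
  have ha : 0 < quart (t + 1) := quart_pos (by omega)
  have hab := quart_mono (Nat.le_succ t)
  have h := quart_succ_pow_four t
  have h3 : quart t ^ 3 ≤ quart (t + 1) ^ 3 := by gcongr
  have e1 : 1 / quart (t + 1) = quart (t + 1) ^ 3 / (quart t ^ 4 + 1) := by
    rw [← h]; field_simp
  have e2 : quart t ^ 3 / (quart t ^ 4 + 1) ≤ quart (t + 1) ^ 3 / (quart t ^ 4 + 1) := by gcongr
  have e3 : 1 / quart t - 1 / quart t ^ 5 ≤ quart t ^ 3 / (quart t ^ 4 + 1) := by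
    rw [le_div_iff₀ (by positivity)]
    field_simp
    ring_nf
    linarith
  linarith

theorem quart_succ_le {t : ℕ} (ht : 1 ≤ t) : quart (t + 1) ≤ 2 * quart t := by
  have h1 := one_le_quart ht
  refine le_of_pow_le_pow_left₀ (n := 4) (by norm_num) (by positivity) ?_
  rw [quart_succ_pow_four, mul_pow]
  nlinarith [one_le_pow₀ h1 (n := 4)]

/-- The sum telescopes: `1 = a⁴ - b⁴ ≤ 4a³(a - b)` for consecutive fourth roots `b ≤ a`. -/
theorem sum_inv_quart_cube_le (T : ℕ) :
    ∑ t ∈ Finset.Icc 1 T, 1 / quart t ^ 3 ≤ 4 * quart T := by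
  induction T with
  | zero => simp [quart_nonneg]
  | succ T ih =>
    rw [Finset.sum_Icc_succ_top (by omega)]
    have ha : 0 < quart (T + 1) := quart_pos (by omega)
    have hb := quart_nonneg T
    have hab := quart_mono (Nat.le_succ T)
    have h := quart_succ_pow_four T
    have : 1 / quart (T + 1) ^ 3 ≤ 4 * (quart (T + 1) - quart T) := by
      rw [div_le_iff₀ (by positivity)]
      set a := quart (T + 1)
      set b := quart T
      have e : 1 = (a - b) * (a ^ 3 + a ^ 2 * b + a * b ^ 2 + b ^ 3) := by linear_combination -h
      have h1 : a ^ 2 * b ≤ a ^ 2 * a := by gcongr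
      have h2 : a * b ^ 2 ≤ a * a ^ 2 := by gcongr
      have h3 : b ^ 3 ≤ a ^ 3 := by gcongr
      have h4 := mul_le_mul_of_nonneg_left (show a ^ 3 + a ^ 2 * b + a * b ^ 2 + b ^ 3 ≤ 4 * a ^ 3
        by linarith) (sub_nonneg.mpr hab)
      linarith
    linarith

end Quartic

/-! ### Exponential weights. -/

section Hedge

/-- Hoeffding's lemma for a centred finite distribution: on `[-c, c]` the exponential lies below its
chord, whose mean is `cosh c ≤ exp (c²/2)`. -/
theorem sum_mul_exp_le {κ : Type*} (s : Finset κ) {ω x : κ → ℝ} (hω : ∀ m ∈ s, 0 ≤ ω m)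
    (hsum : ∑ m ∈ s, ω m = 1) (hmean : ∑ m ∈ s, ω m * x m = 0) {c : ℝ}
    (hx : ∀ m ∈ s, |x m| ≤ c) :
    ∑ m ∈ s, ω m * Real.exp (x m) ≤ Real.exp (c ^ 2 / 2) := by
  refine le_trans ?_ (Real.cosh_le_exp_half_sq c)
  have hne : s.Nonempty := by
    rw [Finset.nonempty_iff_ne_empty]; rintro rfl; simp at hsum
  have hc : 0 ≤ c := (abs_nonneg _).trans (hx _ hne.choose_spec)
  rcases hc.eq_or_lt with rfl | hc
  · have : ∀ m ∈ s, ω m * Real.exp (x m) = ω m := by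
      intro m hm
      have : x m = 0 := by simpa using hx m hm
      simp [this]
    rw [Finset.sum_congr rfl this, hsum]
    simp
  · have hb : ∀ m ∈ s, ω m * Real.exp (x m) ≤
        ω m * Real.cosh c + (Real.sinh c / c) * (ω m * x m) := by
      intro m hm
      have h := abs_le.mp (hx m hm)
      have hcv := convexOn_exp.2 (Set.mem_univ (-c)) (Set.mem_univ c)
        (show 0 ≤ (c - x m) / (2 * c) by apply div_nonneg <;> linarith)
        (show 0 ≤ (x m + c) / (2 * c) by apply div_nonneg <;> linarith) (by field_simp; ring)
      have e : ((c - x m) / (2 * c)) • (-c) + ((x m + c) / (2 * c)) • c = x m := by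
        simp only [smul_eq_mul]; field_simp; ring
      rw [e] at hcv
      simp only [smul_eq_mul] at hcv
      have e2 : (c - x m) / (2 * c) * Real.exp (-c) + (x m + c) / (2 * c) * Real.exp c =
          Real.cosh c + Real.sinh c / c * x m := by
        rw [Real.cosh_eq, Real.sinh_eq]; field_simp; ring
      rw [e2] at hcv
      have := mul_le_mul_of_nonneg_left hcv (hω m hm)
      linarith
    refine (Finset.sum_le_sum hb).trans ?_
    rw [Finset.sum_add_distrib, ← Finset.sum_mul, ← Finset.mul_sum, hsum, hmean]
    simp

/-- The logarithm of the weight of `k` telescopes. Each normaliser costs at most `(ε c)²/2` by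
`sum_mul_exp_le`, because the weighted losses have mean zero, and the final weight is at most 1. -/
theorem exponential_weights_regret {κ : Type*} (s : Finset κ) {ω ℓ : ℕ → κ → ℝ} {c : ℕ → ℝ}
    {ε : ℝ} (hε : 0 < ε) {T : ℕ} (hω : ∀ t, ∀ m ∈ s, 0 < ω t m)
    (hsum : ∀ t, ∑ m ∈ s, ω t m = 1)
    (hstep : ∀ t, 1 ≤ t → ∀ m, ω (t + 1) m = ω t m * Real.exp (-ε * ℓ t m) /
      ∑ m' ∈ s, ω t m' * Real.exp (-ε * ℓ t m'))
    (hmean : ∀ t ∈ Finset.Icc 1 T, ∑ m ∈ s, ω t m * ℓ t m = 0)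
    (hc : ∀ t ∈ Finset.Icc 1 T, ∀ m ∈ s, |ℓ t m| ≤ c t) {k : κ} (hk : k ∈ s) :
    -∑ t ∈ Finset.Icc 1 T, ℓ t k ≤
      Real.log (1 / ω 1 k) / ε + ∑ t ∈ Finset.Icc 1 T, ε * c t ^ 2 / 2 := by
  have key : ∀ N ≤ T, -ε * ∑ t ∈ Finset.Icc 1 N, ℓ t k ≤
      Real.log (ω (N + 1) k) - Real.log (ω 1 k) + ∑ t ∈ Finset.Icc 1 N, ε ^ 2 * c t ^ 2 / 2 := by
    intro N
    induction N with
    | zero => simp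
    | succ N ih =>
      intro hN
      have ih := ih (by omega)
      have hmem : N + 1 ∈ Finset.Icc 1 T := Finset.mem_Icc.mpr ⟨by omega, hN⟩
      rw [Finset.sum_Icc_succ_top (by omega), Finset.sum_Icc_succ_top (by omega), mul_add]
      set Z := ∑ m' ∈ s, ω (N + 1) m' * Real.exp (-ε * ℓ (N + 1) m') with hZ
      have hZpos : 0 < Z :=
        Finset.sum_pos (fun m hm => mul_pos (hω _ m hm) (Real.exp_pos _)) ⟨k, hk⟩
      have hZle : Z ≤ Real.exp ((ε * c (N + 1)) ^ 2 / 2) := by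
        refine sum_mul_exp_le s (fun m hm => (hω _ m hm).le) (hsum _) ?_ ?_
        · have := congrArg (-ε * ·) (hmean _ hmem)
          simp only [Finset.mul_sum, mul_zero] at this
          rw [← this]
          exact Finset.sum_congr rfl fun m _ => by ring
        · intro m hm
          rw [abs_mul, abs_neg, abs_of_pos hε]
          gcongr
          exact hc _ hmem m hm
      have hlogZ : Real.log Z ≤ (ε * c (N + 1)) ^ 2 / 2 := by
        rw [← Real.log_exp ((ε * c (N + 1)) ^ 2 / 2)]
        exact Real.log_le_log hZpos hZle
      rw [hstep (N + 1) (by omega) k, Real.log_div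
        (mul_pos (hω _ k hk) (Real.exp_pos _)).ne' hZpos.ne',
        Real.log_mul (hω _ k hk).ne' (Real.exp_pos _).ne', Real.log_exp]
      rw [mul_pow] at hlogZ
      linarith
  have h := key T le_rfl
  have hle1 : ω (T + 1) k ≤ 1 := by
    rw [← hsum (T + 1)]
    exact Finset.single_le_sum (fun m hm => (hω (T + 1) m hm).le) hk
  have hlog : Real.log (ω (T + 1) k) ≤ 0 := Real.log_nonpos (hω _ k hk).le hle1
  have e : ∑ t ∈ Finset.Icc 1 T, ε ^ 2 * c t ^ 2 / 2 =
      ε * ∑ t ∈ Finset.Icc 1 T, ε * c t ^ 2 / 2 := by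
    rw [Finset.mul_sum]; exact Finset.sum_congr rfl fun t _ => by ring
  rw [e] at h
  rw [one_div, Real.log_inv, ← sub_nonneg]
  have : 0 ≤ ε * (-Real.log (ω 1 k) / ε + ∑ t ∈ Finset.Icc 1 T, ε * c t ^ 2 / 2 -
      -∑ t ∈ Finset.Icc 1 T, ℓ t k) := by
    rw [mul_sub, mul_add, mul_div_cancel₀ _ hε.ne']
    linarith
  exact nonneg_of_mul_nonneg_right this hε

end Hedge

/-! ### Euclidean projection onto closed convex sets. -/

section Projection

variable {E : Type*} [NormedAddCommGroup E] [InnerProductSpace ℝ E] [CompleteSpace E]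
  {S : Set E}

theorem proj_spec (hne : S.Nonempty) (hcl : IsClosed S) (hcv : Convex ℝ S) (x : E) :
    proj S x ∈ S ∧ ∀ w ∈ S, ‖x - proj S x‖ ≤ ‖x - w‖ := by
  refine Classical.epsilon_spec (p := fun y => y ∈ S ∧ ∀ w ∈ S, ‖x - y‖ ≤ ‖x - w‖) ?_
  obtain ⟨y, hy, h⟩ := exists_norm_eq_iInf_of_complete_convex hne hcl.isComplete hcv x
  refine ⟨y, hy, fun w hw => ?_⟩
  rw [h]
  exact ciInf_le ⟨0, by rintro _ ⟨_, rfl⟩; exact norm_nonneg _⟩ (⟨w, hw⟩ : S)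

theorem inner_proj_le_zero (hne : S.Nonempty) (hcl : IsClosed S) (hcv : Convex ℝ S) (x : E)
    {w : E} (hw : w ∈ S) : inner ℝ (x - proj S x) (w - proj S x) ≤ 0 := by
  obtain ⟨hm, h⟩ := proj_spec hne hcl hcv x
  refine (norm_eq_iInf_iff_real_inner_le_zero hcv hm).mp ?_ w hw
  have : Nonempty S := hne.to_subtype
  refine le_antisymm (le_ciInf fun w => h w w.2) ?_
  exact ciInf_le ⟨0, by rintro _ ⟨_, rfl⟩; exact norm_nonneg _⟩ (⟨_, hm⟩ : S)

/-- Adding the variational inequalities at the two projections gives `‖p - q‖² ≤ ⟨x - y, p - q⟩`;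
Cauchy–Schwarz finishes. -/
theorem norm_proj_sub_le (hne : S.Nonempty) (hcl : IsClosed S) (hcv : Convex ℝ S) (x y : E) :
    ‖proj S x - proj S y‖ ≤ ‖x - y‖ := by
  have h1 := inner_proj_le_zero hne hcl hcv x (proj_spec hne hcl hcv y).1
  have h2 := inner_proj_le_zero hne hcl hcv y (proj_spec hne hcl hcv x).1
  set p := proj S x
  set q := proj S y
  have h3 : inner ℝ (p - q) (p - q) ≤ inner ℝ (x - y) (p - q) := by
    simp only [inner_sub_left, inner_sub_right] at h1 h2 ⊢
    simp only [real_inner_comm] at h1 h2 ⊢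
    linarith
  have h4 := h3.trans (real_inner_le_norm _ _)
  rw [real_inner_self_eq_norm_mul_norm] at h4
  by_contra! hlt
  have : 0 < ‖p - q‖ := (norm_nonneg _).trans_lt hlt
  nlinarith

theorem proj_eq_self (hne : S.Nonempty) (hcl : IsClosed S) (hcv : Convex ℝ S) {x : E}
    (hx : x ∈ S) : proj S x = x := by
  have := (proj_spec hne hcl hcv x).2 x hx
  simp only [sub_self, norm_zero, norm_le_zero_iff, sub_eq_zero] at this
  exact this.symm

theorem norm_proj_sub_le_of_mem (hne : S.Nonempty) (hcl : IsClosed S) (hcv : Convex ℝ S) (x : E)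
    {w : E} (hw : w ∈ S) : ‖proj S x - w‖ ≤ ‖x - w‖ := by
  simpa [proj_eq_self hne hcl hcv hw] using norm_proj_sub_le hne hcl hcv x w

theorem continuous_proj (hne : S.Nonempty) (hcl : IsClosed S) (hcv : Convex ℝ S) :
    Continuous (proj S) :=
  (LipschitzWith.of_dist_le_mul (K := 1) fun x y => by
    simpa [dist_eq_norm] using norm_proj_sub_le hne hcl hcv x y).continuous

end Projection

/-! ### Online gradient descent against a moving comparator. -/

section GradientDescent

/-- Abel summation, with the nonnegative boundary term `h (T + 1) * b T` dropped. -/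
theorem sum_mul_sub_le_by_parts {h a b : ℕ → ℝ} (hh : ∀ t, 0 ≤ h t) (hb : ∀ t, 0 ≤ b t) {T : ℕ}
    (hT : 1 ≤ T) :
    ∑ t ∈ Finset.Icc 1 T, h (t + 1) * (a t - b t) ≤
      h 1 * a 1 + ∑ t ∈ Finset.Icc 1 T, (h (t + 1) - h t) * a t
        + ∑ t ∈ Finset.Icc 2 T, h t * (a t - b (t - 1)) := by
  have key : ∑ t ∈ Finset.Icc 1 T, h (t + 1) * (a t - b t) + h (T + 1) * b T =
      h 1 * a 1 + ∑ t ∈ Finset.Icc 1 T, (h (t + 1) - h t) * a t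
        + ∑ t ∈ Finset.Icc 2 T, h t * (a t - b (t - 1)) := by
    induction T, hT using Nat.le_induction with
    | base => simp; ring
    | succ T hT ih =>
      rw [Finset.sum_Icc_succ_top (by omega), Finset.sum_Icc_succ_top (by omega),
        Finset.sum_Icc_succ_top (by omega), Nat.add_sub_cancel]
      linear_combination ih
  have := mul_nonneg (hh (T + 1)) (hb T)
  linarith

variable {E : Type*} [NormedAddCommGroup E] [InnerProductSpace ℝ E]

/-- Expand the square of the right-hand norm. A projection enters only through the assumed
comparison of distances to `w`. -/
theorem inner_le_of_norm_le {z z' g w : E} {η : ℝ} (hη : 0 < η)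
    (h : ‖z' - w‖ ≤ ‖z - η • g - w‖) :
    inner ℝ g (z - w) ≤ (‖z - w‖ ^ 2 - ‖z' - w‖ ^ 2) / (2 * η) + η / 2 * ‖g‖ ^ 2 := by
  have h2 : ‖z' - w‖ ^ 2 ≤ ‖z - η • g - w‖ ^ 2 := by gcongr
  have e : z - η • g - w = (z - w) - η • g := by abel
  rw [e, norm_sub_sq_real (z - w), inner_smul_right, norm_smul, mul_pow, Real.norm_eq_abs, sq_abs,
    real_inner_comm] at h2
  have e2 : (‖z - w‖ ^ 2 - ‖z' - w‖ ^ 2) / (2 * η) + η / 2 * ‖g‖ ^ 2 =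
      (‖z - w‖ ^ 2 - ‖z' - w‖ ^ 2 + η ^ 2 * ‖g‖ ^ 2) / (2 * η) := by field_simp
  rw [e2, le_div_iff₀ (by positivity)]
  linarith

/-- Dynamic regret of online gradient descent with step sizes `b / t ^ (3/4)` on a family of sets
whose diameters are of the order `(T / t) ^ (1/4)`. -/
theorem online_gradient_descent_regret {z g w v : ℕ → E} {T : ℕ} (hT : 1 ≤ T) {b D Γ : ℝ}
    (hb : 0 < b) (hD : 0 ≤ D)
    (hstep : ∀ t ∈ Finset.Icc 1 T,
      ‖z (t + 1) - w t‖ ≤ ‖z t - (b / quart (t + 1) ^ 3) • g t - w t‖)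
    (hz : ∀ t ∈ Finset.Icc 1 T, ‖z t‖ ≤ D * (quart T / quart t))
    (hw : ∀ t ∈ Finset.Icc 1 T, ‖w t‖ ≤ D * (quart T / quart t))
    (hg : ∀ t ∈ Finset.Icc 1 T, ‖g t‖ ≤ Γ * quart T)
    (hdw : ∀ t ∈ Finset.Icc 2 T, ‖w t - w (t - 1)‖ ≤
      D * (quart T / quart t) * ‖v t - v (t - 1)‖ + D * (quart T / quart t ^ 5)) :
    ∑ t ∈ Finset.Icc 1 T, inner ℝ (g t) (z t - w t) ≤
      20 * D ^ 2 * quart T ^ 3 * (1 + pathLength T v) / b + 2 * b * Γ ^ 2 * quart T ^ 3 := by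
  set τ := quart T with hτ
  have hτ1 : 1 ≤ τ := one_le_quart hT
  have hP : 0 ≤ pathLength T v := Finset.sum_nonneg fun t _ => norm_nonneg _
  set a : ℕ → ℝ := fun t => ‖z t - w t‖ ^ 2 with ha
  set c : ℕ → ℝ := fun t => ‖z (t + 1) - w t‖ ^ 2 with hc
  have hround : ∀ t ∈ Finset.Icc 1 T, inner ℝ (g t) (z t - w t) ≤
      (1 / (2 * b)) * (quart (t + 1) ^ 3 * (a t - c t))
        + b / 2 * Γ ^ 2 * τ ^ 2 * (1 / quart t ^ 3) := by
    intro t ht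
    have ht1 := (Finset.mem_Icc.mp ht).1
    have hq := quart_pos ht1
    have hq' : 0 < quart (t + 1) := quart_pos (by omega)
    have h := inner_le_of_norm_le (by positivity) (hstep t ht)
    refine h.trans (add_le_add (le_of_eq ?_) ?_)
    · simp only [ha, hc]; field_simp
    · have h1 : ‖g t‖ ^ 2 ≤ (Γ * τ) ^ 2 := by gcongr; exact hg t ht
      have h2 : b / quart (t + 1) ^ 3 / 2 ≤ b / quart t ^ 3 / 2 := by
        gcongr; exact quart_mono (Nat.le_succ t)
      calc _ ≤ b / quart t ^ 3 / 2 * (Γ * τ) ^ 2 := by gcongr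
        _ = _ := by ring
  have hsum1 := sum_inv_quart_cube_le T
  have hat : ∀ t ∈ Finset.Icc 1 T, a t ≤ 4 * D ^ 2 * τ ^ 2 / quart t ^ 2 := by
    intro t ht
    have hn : ‖z t - w t‖ ≤ 2 * (D * (τ / quart t)) := by
      have := norm_sub_le (z t) (w t)
      linarith [hz t ht, hw t ht]
    calc a t ≤ (2 * (D * (τ / quart t))) ^ 2 := by simp only [ha]; gcongr
      _ = _ := by ring
  -- The inverse step sizes grow by at most `1 / quart t`, and the squared diameter is of order `τ²
  -- / quart t²`. Their product is summable by `sum_inv_quart_cube_le`.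
  have hA : ∑ t ∈ Finset.Icc 1 T, (quart (t + 1) ^ 3 - quart t ^ 3) * a t ≤
      16 * D ^ 2 * τ ^ 3 := by
    calc _ ≤ ∑ t ∈ Finset.Icc 1 T, 4 * D ^ 2 * τ ^ 2 * (1 / quart t ^ 3) := by
          refine Finset.sum_le_sum fun t ht => ?_
          have hq := quart_pos (Finset.mem_Icc.mp ht).1
          calc _ ≤ 1 / quart t * (4 * D ^ 2 * τ ^ 2 / quart t ^ 2) :=
                mul_le_mul (quart_succ_cube_sub_le (Finset.mem_Icc.mp ht).1) (hat t ht)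
                  (sq_nonneg _) (by positivity)
            _ = _ := by field_simp
      _ ≤ 4 * D ^ 2 * τ ^ 2 * (4 * τ) := by rw [← Finset.mul_sum]; gcongr
      _ = _ := by ring
  have hB : ∑ t ∈ Finset.Icc 2 T, quart t ^ 3 * (a t - c (t - 1)) ≤
      5 * D ^ 2 * τ ^ 3 * pathLength T v + 20 * D ^ 2 * τ ^ 3 := by
    have hterm : ∀ t ∈ Finset.Icc 2 T, quart t ^ 3 * (a t - c (t - 1)) ≤
        5 * D ^ 2 * τ ^ 3 * ‖v t - v (t - 1)‖ + 5 * D ^ 2 * τ ^ 2 * (1 / quart t ^ 3) := by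
      intro t ht
      obtain ⟨ht2, htT⟩ := Finset.mem_Icc.mp ht
      obtain ⟨s, rfl⟩ : ∃ s, t = s + 1 := ⟨t - 1, by omega⟩
      rw [Nat.add_sub_cancel]
      have hq : 0 < quart (s + 1) := quart_pos (by omega)
      have hq0 : 0 < quart s := quart_pos (by omega)
      have hqT : quart (s + 1) ≤ τ := quart_mono htT
      have hd := hdw (s + 1) ht
      rw [Nat.add_sub_cancel] at hd
      have hzt := hz (s + 1) (Finset.mem_Icc.mpr ⟨by omega, htT⟩)
      have hwt := hw (s + 1) (Finset.mem_Icc.mpr ⟨by omega, htT⟩)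
      have hws := hw s (Finset.mem_Icc.mpr ⟨by omega, by omega⟩)
      -- The previous comparator lies in the larger ball of round `s`; passing to the radius of
      -- round `s + 1` costs a factor 2. Hence the 5 = 2 + 3 in `hx`.
      have hws' : ‖w s‖ ≤ 2 * (D * (τ / quart (s + 1))) := by
        refine hws.trans ?_
        have : τ / quart s ≤ 2 * (τ / quart (s + 1)) := by
          rw [← mul_div_assoc, div_le_div_iff₀ hq0 hq]
          nlinarith [quart_succ_le (t := s) (by omega)]
        nlinarith
      have hx : ‖z (s + 1) - w (s + 1)‖ + ‖z (s + 1) - w s‖ ≤ 5 * (D * (τ / quart (s + 1))) := by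
        have h1 := norm_sub_le (z (s + 1)) (w (s + 1))
        have h2 := norm_sub_le (z (s + 1)) (w s)
        linarith
      have hy : ‖z (s + 1) - w (s + 1)‖ - ‖z (s + 1) - w s‖ ≤ ‖w (s + 1) - w s‖ := by
        have := norm_sub_norm_le (z (s + 1) - w (s + 1)) (z (s + 1) - w s)
        rw [sub_sub_sub_cancel_left, norm_sub_rev (w s)] at this
        exact this
      have hdiff : a (s + 1) - c s ≤ 5 * (D * (τ / quart (s + 1))) *
          (D * (τ / quart (s + 1)) * ‖v (s + 1) - v s‖ + D * (τ / quart (s + 1) ^ 5)) := by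
        calc a (s + 1) - c s = (‖z (s + 1) - w (s + 1)‖ + ‖z (s + 1) - w s‖) *
              (‖z (s + 1) - w (s + 1)‖ - ‖z (s + 1) - w s‖) := by simp only [ha, hc]; ring
          _ ≤ (‖z (s + 1) - w (s + 1)‖ + ‖z (s + 1) - w s‖) * ‖w (s + 1) - w s‖ := by gcongr
          _ ≤ _ := by gcongr
      calc _ ≤ quart (s + 1) ^ 3 * (5 * (D * (τ / quart (s + 1))) *
          (D * (τ / quart (s + 1)) * ‖v (s + 1) - v s‖ + D * (τ / quart (s + 1) ^ 5))) := by
            gcongr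
        _ = 5 * D ^ 2 * τ ^ 2 * quart (s + 1) * ‖v (s + 1) - v s‖ +
            5 * D ^ 2 * τ ^ 2 * (1 / quart (s + 1) ^ 3) := by field_simp
        _ ≤ 5 * D ^ 2 * τ ^ 2 * τ * ‖v (s + 1) - v s‖ +
            5 * D ^ 2 * τ ^ 2 * (1 / quart (s + 1) ^ 3) := by gcongr
        _ = _ := by ring
    refine (Finset.sum_le_sum hterm).trans ?_
    rw [Finset.sum_add_distrib, ← Finset.mul_sum, ← Finset.mul_sum]
    have hsub : ∑ t ∈ Finset.Icc 2 T, 1 / quart t ^ 3 ≤ 4 * τ :=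
      (Finset.sum_le_sum_of_subset_of_nonneg (Finset.Icc_subset_Icc_left (by norm_num))
        fun t _ _ => by have := quart_nonneg t; positivity).trans hsum1
    have : 5 * D ^ 2 * τ ^ 2 * ∑ t ∈ Finset.Icc 2 T, 1 / quart t ^ 3 ≤
        5 * D ^ 2 * τ ^ 2 * (4 * τ) := by gcongr
    unfold pathLength
    linarith
  have hparts := sum_mul_sub_le_by_parts (h := fun t => quart t ^ 3) (a := a) (b := c)
    (fun t => pow_nonneg (quart_nonneg t) 3) (fun t => sq_nonneg _) hT
  have ha1 : quart 1 ^ 3 * a 1 ≤ 4 * D ^ 2 * τ ^ 3 := by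
    have h := hat 1 (Finset.mem_Icc.mpr ⟨le_rfl, hT⟩)
    rw [quart_one] at h ⊢
    have : τ ^ 2 ≤ τ ^ 3 := pow_le_pow_right₀ hτ1 (by norm_num)
    nlinarith [mul_le_mul_of_nonneg_left this (sq_nonneg D)]
  refine (Finset.sum_le_sum hround).trans ?_
  rw [Finset.sum_add_distrib, ← Finset.mul_sum, ← Finset.mul_sum]
  have h1 : ∑ t ∈ Finset.Icc 1 T, quart (t + 1) ^ 3 * (a t - c t) ≤
      40 * D ^ 2 * τ ^ 3 * (1 + pathLength T v) := by
    have : 0 ≤ D ^ 2 * τ ^ 3 * pathLength T v := by positivity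
    linarith
  have h2 : b / 2 * Γ ^ 2 * τ ^ 2 * ∑ t ∈ Finset.Icc 1 T, 1 / quart t ^ 3 ≤
      b / 2 * Γ ^ 2 * τ ^ 2 * (4 * τ) := by gcongr
  have h3 : 1 / (2 * b) * ∑ t ∈ Finset.Icc 1 T, quart (t + 1) ^ 3 * (a t - c t) ≤
      1 / (2 * b) * (40 * D ^ 2 * τ ^ 3 * (1 + pathLength T v)) := by gcongr
  have e1 : 1 / (2 * b) * (40 * D ^ 2 * τ ^ 3 * (1 + pathLength T v)) =
      20 * D ^ 2 * τ ^ 3 * (1 + pathLength T v) / b := by field_simp; ring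
  linarith

end GradientDescent

/-! ### Properties of the loss and the adjustment on the whole allocation space. -/

section Loss

variable {V : Type*} [Fintype V] {Gr : SimpleGraph V}

theorem mem_closedNbhd {i j : V} : j ∈ closedNbhd Gr i ↔ j = i ∨ Gr.Adj i j := by
  simp [closedNbhd]

theorem mem_closedNbhd_comm {i j : V} : j ∈ closedNbhd Gr i ↔ i ∈ closedNbhd Gr j := by
  rw [mem_closedNbhd, mem_closedNbhd, eq_comm, Gr.adj_comm]

theorem closedNbhd_card_pos (i : V) : (0 : ℝ) < (closedNbhd Gr i).card := by
  exact_mod_cast Finset.card_pos.mpr ⟨i, mem_closedNbhd.mpr (Or.inl rfl)⟩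

theorem abs_transfer_le (y : ∀ k, Alloc Gr k) (k j : V) : |transfer y k j| ≤ ‖y k‖ := by
  unfold transfer
  split_ifs with h
  · exact PiLp.norm_apply_le (y k) ⟨j, h⟩
  · simp

theorem loss_nonneg (l : V → ℝ) (y : ∀ k, Alloc Gr k) (i : V) : 0 ≤ loss l y i := by
  have hn := closedNbhd_card_pos (Gr := Gr) i
  have h : ∑ j ∈ closedNbhd Gr i, satisfaction l y j ≤ (closedNbhd Gr i).card := by
    have := Finset.sum_le_card_nsmul (closedNbhd Gr i) (satisfaction l y) 1
      fun j _ => min_le_right _ _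
    simpa using this
  unfold loss
  rw [sub_nonneg, one_div, inv_mul_le_iff₀ hn]
  linarith

/-- Perturbed decisions may have negative coordinates, so a satisfaction level can be negative. It
is still at least minus the total transferred amount divided by `lmin`. -/
theorem loss_le {l : V → ℝ} {lmin : ℝ} (hl0 : 0 < lmin) (hl : ∀ j, lmin ≤ l j)
    (y : ∀ k, Alloc Gr k) (i : V) : loss l y i ≤ 1 + 1 / lmin * ∑ k, ‖y k‖ := by
  have hn := closedNbhd_card_pos (Gr := Gr) i
  set A := 1 / lmin * ∑ k, ‖y k‖ with hA
  have hA0 : 0 ≤ A := by positivity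
  have hs : ∀ j, -A ≤ satisfaction l y j := by
    intro j
    refine le_min ?_ (by linarith)
    have h1 : |∑ k ∈ closedNbhd Gr j, transfer y k j| ≤ ∑ k, ‖y k‖ :=
      (Finset.abs_sum_le_sum_abs _ _).trans
        ((Finset.sum_le_sum fun k _ => abs_transfer_le y k j).trans
          (Finset.sum_le_sum_of_subset_of_nonneg (Finset.subset_univ _)
            fun _ _ _ => norm_nonneg _))
    have hlj : 0 < l j := hl0.trans_le (hl j)
    refine (abs_le.mp ?_).1
    rw [abs_div, abs_of_pos hlj, hA, div_eq_mul_one_div, mul_comm]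
    exact mul_le_mul (one_div_le_one_div_of_le hl0 (hl j)) h1 (abs_nonneg _) (by positivity)
  have h : -((closedNbhd Gr i).card * A) ≤ ∑ j ∈ closedNbhd Gr i, satisfaction l y j := by
    have := Finset.card_nsmul_le_sum (closedNbhd Gr i) (satisfaction l y) (-A)
      fun j _ => hs j
    simpa using this
  unfold loss
  have : -A ≤ 1 / ((closedNbhd Gr i).card : ℝ) * ∑ j ∈ closedNbhd Gr i, satisfaction l y j := by
    rw [one_div, ← div_eq_inv_mul, le_div_iff₀ hn]
    linarith
  linarith

open Classical in
/-- As a function of the own allocation of a node, its loss is a sum of convex Lipschitz functions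
of the coordinates. -/
theorem exists_separable_loss {l : V → ℝ} {lmin : ℝ} (hl0 : 0 < lmin) (hl : ∀ j, lmin ≤ l j)
    (y : ∀ k, Alloc Gr k) (i : V) :
    ∃ φ : closedNbhd Gr i → ℝ → ℝ, (∀ j, ConvexOn ℝ Set.univ (φ j)) ∧
      (∀ j u v, |φ j u - φ j v| ≤ 1 / lmin / (closedNbhd Gr i).card * |u - v|) ∧
      ∀ x, loss l (Function.update y i x) i = 1 + ∑ j, φ j (x j) := by
  have hn := closedNbhd_card_pos (Gr := Gr) i
  set n : ℝ := ((closedNbhd Gr i).card : ℝ) with hn'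
  -- The amount that `j` receives from the nodes other than `i`. It is fixed, so the satisfaction of
  -- `j` is the minimum of an affine function of the single number `x j` and 1, which is concave.
  set c : V → ℝ := fun j => ∑ k ∈ (closedNbhd Gr j).erase i, transfer y k j with hc
  refine ⟨fun j u => -(1 / n) * min ((c j + u) / l j) 1, ?_, ?_, ?_⟩
  · intro j
    have hlin : ConcaveOn ℝ Set.univ (fun u : ℝ => (c j + u) / l j) := by
      refine ⟨convex_univ, fun u _ v _ a b _ _ hab => le_of_eq ?_⟩
      simp only [smul_eq_mul]
      linear_combination (c j / l j) * hab
    have := (hlin.inf (concaveOn_const (1 : ℝ) convex_univ)).neg.smul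
      (show 0 ≤ 1 / n by positivity)
    have e : (fun u : ℝ => -(1 / n) * min ((c j + u) / l j) 1) =
        fun u => (1 / n) • (-((fun u : ℝ => (c j + u) / l j) ⊓ fun _ => 1)) u := by
      ext u
      simp [Pi.inf_apply]
    simp only [e]
    exact this
  · intro j u v
    have hlj : 0 < l j := hl0.trans_le (hl j)
    rw [← mul_sub, abs_mul, abs_neg, abs_of_pos (by positivity)]
    have h1 := abs_min_sub_min_le_max ((c j + u) / l j) 1 ((c j + v) / l j) 1
    rw [sub_self, abs_zero, max_eq_left (abs_nonneg _), ← sub_div, add_sub_add_left_eq_sub,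
      abs_div, abs_of_pos hlj] at h1
    have h2 : |u - v| / l j ≤ |u - v| / lmin := by gcongr; exact hl j
    calc _ ≤ 1 / n * (|u - v| / lmin) := by gcongr; exact h1.trans h2
      _ = _ := by field_simp
  · intro x
    unfold loss
    rw [sub_eq_add_neg, ← neg_mul, Finset.mul_sum,
      ← Finset.sum_coe_sort (closedNbhd Gr i)]
    congr 1
    refine Finset.sum_congr rfl fun j _ => ?_
    congr 1
    unfold satisfaction
    congr 2
    rw [← Finset.sum_erase_add _ _ (mem_closedNbhd_comm.mp j.2)]
    congr 1
    · refine Finset.sum_congr rfl fun k hk => ?_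
      simp [transfer, Function.update_of_ne (Finset.ne_of_mem_erase hk)]
    · simp [transfer]

open Classical in
theorem abs_loss_update_sub_le {l : V → ℝ} {lmin : ℝ} (hl0 : 0 < lmin) (hl : ∀ j, lmin ≤ l j)
    (y : ∀ k, Alloc Gr k) (i : V) (x x' : Alloc Gr i) :
    |loss l (Function.update y i x) i - loss l (Function.update y i x') i| ≤
      1 / lmin * ‖x - x'‖ := by
  obtain ⟨φ, -, hL, h⟩ := exists_separable_loss hl0 hl y i
  have hn := closedNbhd_card_pos (Gr := Gr) i
  rw [h, h, add_sub_add_left_eq_sub, ← Finset.sum_sub_distrib]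
  refine (Finset.abs_sum_le_sum_abs _ _).trans ?_
  calc _ ≤ ∑ j : closedNbhd Gr i, 1 / lmin / (closedNbhd Gr i).card * ‖x - x'‖ := by
        refine Finset.sum_le_sum fun j _ => (hL j _ _).trans ?_
        gcongr
        exact PiLp.norm_apply_le (x - x') j
    _ = _ := by
        rw [Finset.sum_const, Finset.card_univ, Fintype.card_coe, nsmul_eq_mul]
        field_simp

variable {i : V}

/-- Rescaling makes the total exactly `d`; without rescaling it is already at most `d`. This is why
the dual variables never leave 0. -/
theorem constr_adjust_nonpos (x : Alloc Gr i) {d : ℝ} (hd : 0 ≤ d) :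
    constr (adjust x d) d ≤ 0 := by
  unfold constr adjust
  split_ifs with h
  · have h0 : ∑ j, x j ≠ 0 := (hd.trans_lt h).ne'
    simp only [PiLp.smul_apply, smul_eq_mul, ← Finset.mul_sum]
    rw [div_mul_cancel₀ _ h0]
    simp
  · linarith

theorem norm_adjust_le (x : Alloc Gr i) {d : ℝ} (hd : 0 ≤ d) : ‖adjust x d‖ ≤ ‖x‖ := by
  unfold adjust
  split_ifs with h
  · have h0 : 0 < ∑ j, x j := hd.trans_lt h
    rw [norm_smul, Real.norm_eq_abs, abs_of_nonneg (by positivity)]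
    exact mul_le_of_le_one_left (norm_nonneg _) ((div_le_one h0).mpr h.le)
  · exact le_rfl

end Loss

/-! ### Constants depending only on the network. -/

section Constants

variable {V : Type*} [Fintype V] (net : Network V) (k : V)

/-- A bound of the norms of the actions of node `k`. -/
noncomputable def Network.outer : ℝ := ‖net.center k‖ + net.R k

/-- The smoothing radius of node `k` is `smooth / t ^ (1/4)`. -/
noncomputable def Network.smooth (p : ℝ) : ℝ :=
  (net.deg k * net.F k / net.lipTilde k) ^ (1 / 2 : ℝ) *
    (net.R k ^ 2 / 2 + net.R k * p) ^ (1 / 4 : ℝ)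

/-- A bound of `smooth / T ^ (1/4)` over all path lengths of sequences of actions. -/
noncomputable def Network.smoothTop : ℝ :=
  (net.deg k * net.F k / net.lipTilde k) ^ (1 / 2 : ℝ) *
    (net.R k ^ 2 / 2 + 2 * net.R k ^ 2) ^ (1 / 4 : ℝ)

/-- A bound of `smooth / (1 + P) ^ (1/2)`, where `P` is the path length. -/
noncomputable def Network.smoothPath : ℝ :=
  (net.deg k * net.F k / net.lipTilde k) ^ (1 / 2 : ℝ) *
    (net.R k ^ 2 / 2 + net.R k) ^ (1 / 4 : ℝ)

theorem Network.lip_pos : 0 < net.lip := one_div_pos.mpr net.minDemand_pos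

theorem Network.lipTilde_pos : 0 < net.lipTilde k := by
  have := net.lip_pos
  have := net.R_pos k
  have := net.r_pos k
  unfold Network.lipTilde
  positivity

theorem Network.outer_pos : 0 < net.outer k :=
  add_pos_of_nonneg_of_pos (norm_nonneg _) (net.R_pos k)

theorem Network.deg_nonneg : 0 ≤ net.deg k := Nat.cast_nonneg _

theorem Network.deg_pos (hk : (nbhd net.graph k).Nonempty) : 0 < net.deg k := by
  unfold Network.deg
  exact_mod_cast Finset.card_pos.mpr hk

theorem Network.dim_pos : 0 < net.dim k := closedNbhd_card_pos k

theorem Network.ratio_nonneg : 0 ≤ net.deg k * net.F k / net.lipTilde k :=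
  div_nonneg (mul_nonneg (net.deg_nonneg k) (net.F_pos k).le) (net.lipTilde_pos k).le

theorem Network.delta_eq {p : ℝ} (hp : 0 ≤ p) (t : ℕ) :
    net.delta k p t = net.smooth k p / quart t := by
  have := net.R_pos k
  unfold Network.delta Network.smooth quart
  rw [Real.div_rpow (x := net.R k ^ 2 / 2 + net.R k * p) (by positivity) (by positivity)]
  ring

theorem Network.smooth_nonneg {p : ℝ} (hp : 0 ≤ p) : 0 ≤ net.smooth k p := by
  have := net.R_pos k
  have := net.ratio_nonneg k
  unfold Network.smooth
  positivity

theorem Network.smoothTop_nonneg : 0 ≤ net.smoothTop k := by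
  have := net.ratio_nonneg k
  unfold Network.smoothTop
  positivity

theorem Network.smoothPath_nonneg : 0 ≤ net.smoothPath k := by
  have := net.R_pos k
  have := net.ratio_nonneg k
  unfold Network.smoothPath
  positivity

theorem Network.smooth_zero_pos (hk : (nbhd net.graph k).Nonempty) : 0 < net.smooth k 0 := by
  have := net.R_pos k
  have := net.deg_pos k hk
  have := net.F_pos k
  have := net.lipTilde_pos k
  unfold Network.smooth
  positivity

theorem Network.smooth_zero_le {p : ℝ} (hp : 0 ≤ p) : net.smooth k 0 ≤ net.smooth k p := by
  have := net.R_pos k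
  have := net.ratio_nonneg k
  unfold Network.smooth
  gcongr

/-- Since `p` is at most linear in `T`, its fourth root contributes at most a factor `T^(1/4)`. This
bound serves for sizes of iterates. -/
theorem Network.smooth_le_smoothTop {p : ℝ} (hp : 0 ≤ p) {T : ℕ} (hT : 1 ≤ T)
    (hpT : p ≤ 2 * net.R k * T) : net.smooth k p ≤ net.smoothTop k * quart T := by
  have hR := net.R_pos k
  have := net.ratio_nonneg k
  have hT' : (1 : ℝ) ≤ T := by exact_mod_cast hT
  unfold Network.smooth Network.smoothTop quart
  rw [mul_assoc, ← Real.mul_rpow (by positivity) (by positivity)]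
  gcongr
  nlinarith [mul_le_mul_of_nonneg_left hT' (sq_nonneg (net.R k)),
    mul_le_mul_of_nonneg_left hpT hR.le]

/-- The second bound of the radius, in terms of the path length, serves for the regret. Replacing
`(1+P)^(1/4)` by `√(1+P)` is lossy but fits the target rate. -/
theorem Network.smooth_le_smoothPath {p P : ℝ} (hp : 0 ≤ p) (hP : p ≤ P) :
    net.smooth k p ≤ net.smoothPath k * Real.sqrt (1 + P) := by
  have hR := net.R_pos k
  have := net.ratio_nonneg k
  have hP0 : 0 ≤ P := hp.trans hP
  have h1 : (net.R k ^ 2 / 2 + net.R k * p) ^ (1 / 4 : ℝ) ≤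
      (net.R k ^ 2 / 2 + net.R k) ^ (1 / 4 : ℝ) * (1 + P) ^ (1 / 4 : ℝ) := by
    rw [← Real.mul_rpow (by positivity) (by positivity)]
    gcongr
    nlinarith [mul_nonneg (sq_nonneg (net.R k)) hP0, mul_le_mul_of_nonneg_left hP hR.le]
  have h2 : (1 + P) ^ (1 / 4 : ℝ) ≤ Real.sqrt (1 + P) := by
    rw [Real.sqrt_eq_rpow]
    exact Real.rpow_le_rpow_of_exponent_le (by linarith) (by norm_num)
  unfold Network.smooth Network.smoothPath
  rw [mul_assoc]
  gcongr
  exact h1.trans (by gcongr)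

/-- A bound of the norms of the decisions of node `k` in round `t`, relative to
`(T / t) ^ (1/4)`. -/
noncomputable def Network.reach : ℝ :=
  net.outer k + (net.outer k / net.r k + 1) * net.smoothTop k

theorem Network.reach_pos : 0 < net.reach k := by
  have := net.outer_pos k
  have := net.r_pos k
  have := net.smoothTop_nonneg k
  unfold Network.reach
  positivity

/-- A bound of the losses in round `t`, relative to `(T / t) ^ (1/4)`. -/
noncomputable def Network.lossBound : ℝ := 1 + 2 * net.lip * ∑ k, net.reach k

theorem Network.lossBound_pos : 0 < net.lossBound := by
  have := net.lip_pos
  have : 0 ≤ ∑ k, net.reach k := Finset.sum_nonneg fun k _ => (net.reach_pos k).le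
  unfold Network.lossBound
  positivity

/-- A bound of the gradient estimates of node `k`, relative to `T ^ (1/4)`. -/
noncomputable def Network.gradBound : ℝ := net.dim k * net.lossBound / net.smooth k 0

end Constants

/-! ### Invariants and a priori bounds along a run. -/

section Run

variable {V : Type*} [Fintype V] {net : Network V} (S : Scenario net)

/-- The standing assumptions on the data of a run. -/
structure Admissible (I : RunInput net) : Prop where
  one_le_horizon : 1 ≤ I.T
  p_nonneg : ∀ k, 0 ≤ I.p k
  p_le : ∀ k, I.p k ≤ 2 * net.R k * I.T
  gen_nonneg : ∀ k t, 0 ≤ I.gen k t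
  norm_dir : ∀ k t, ‖I.dir k t‖ = 1
  start_mem : ∀ k, I.start k ∈ (1 - net.xi k (I.p k) 1) • S.action k

variable {S} {I : RunInput net}

theorem Scenario.norm_le_outer (S : Scenario net) {k : V} {x : Alloc net.graph k}
    (hx : x ∈ S.action k) : ‖x‖ ≤ net.outer k := by
  have h := S.action_subset k hx
  rw [Metric.mem_closedBall, dist_eq_norm] at h
  have := norm_le_norm_add_norm_sub' x (net.center k)
  unfold Network.outer
  linarith

theorem Scenario.action_nonempty (S : Scenario net) (k : V) : (S.action k).Nonempty := by
  obtain ⟨c, hc⟩ := S.ball_subset k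
  exact ⟨c, hc (Metric.mem_closedBall_self (net.r_pos k).le)⟩

theorem Scenario.shrunk_nonempty (S : Scenario net) (k : V) (a : ℝ) :
    (a • S.action k).Nonempty := (S.action_nonempty k).smul_set

/-- The sign of `a` is irrelevant, so nothing breaks when the shrinkage parameter exceeds 1. The
same is true of closedness, which comes from compactness. -/
theorem Scenario.shrunk_convex (S : Scenario net) (k : V) (a : ℝ) :
    Convex ℝ (a • S.action k) := (S.action_convex k).smul a

theorem Scenario.shrunk_closed (S : Scenario net) (k : V) (a : ℝ) :
    IsClosed (a • S.action k) := by
  have h : IsCompact (S.action k) := Metric.isCompact_of_isClosed_isBounded (S.action_closed k)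
    (Metric.isBounded_closedBall.subset (S.action_subset k))
  exact (h.smul a).isClosed

theorem state_succ (S : Scenario net) (I : RunInput net) {t : ℕ} (ht : 1 ≤ t) :
    state S I (t + 1) = nextState S I t (state S I t) := by
  obtain ⟨t, rfl⟩ := Nat.exists_eq_add_of_le' ht
  rfl

/-- From dual value 0 the update is the positive part of a nonnegative step times a nonpositive
constraint value. -/
theorem nextDual_eq_zero (hI : Admissible S I) {t : ℕ} {s : ∀ k, AgentState (Alloc net.graph k)}
    {k : V} (h : (s k).dual = 0) : nextDual I t s k = 0 := by
  unfold nextDual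
  rw [h, mul_zero, sub_zero, zero_add]
  refine max_eq_left (mul_nonpos_of_nonneg_of_nonpos ?_
    (constr_adjust_nonpos _ (hI.gen_nonneg k t)))
  unfold Network.gamma
  positivity

/-- The constraint is never violated by the adjusted decisions, so the dual variables vanish. -/
theorem state_dual (hI : Admissible S I) (t : ℕ) (k : V) : (state S I t k).dual = 0 := by
  induction t with
  | zero => rfl
  | succ t ih =>
    rcases Nat.eq_zero_or_pos t with rfl | ht
    · rfl
    · rw [state_succ S I ht]
      exact nextDual_eq_zero hI ih

theorem updateDir_eq_gradEst (hI : Admissible S I) (t : ℕ) (k : V) :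
    updateDir S I t (state S I t) k = gradEst S I t (state S I t) k := by
  unfold updateDir gradEst
  rw [nextDual_eq_zero hI (state_dual hI t k)]
  simp [smul_smul]

theorem one_le_numExperts (T : ℕ) : 1 ≤ numExperts T := Nat.le_add_left _ _

theorem priorWeight_pos {K m : ℕ} (hK : 1 ≤ K) (hm : 1 ≤ m) : 0 < priorWeight K m := by
  have : (0 : ℝ) < K := by exact_mod_cast hK
  have : (0 : ℝ) < m := by exact_mod_cast hm
  unfold priorWeight
  positivity

theorem sum_priorWeight {K : ℕ} (hK : 1 ≤ K) : ∑ m ∈ Finset.Icc 1 K, priorWeight K m = 1 := by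
  have h : ∀ N : ℕ, ∑ m ∈ Finset.Icc 1 N, 1 / ((m : ℝ) * ((m : ℝ) + 1)) = N / (N + 1) := by
    intro N
    induction N with
    | zero => simp
    | succ N ih =>
      rw [Finset.sum_Icc_succ_top (by omega), ih]
      push_cast
      field_simp
      ring
  have : (0 : ℝ) < K := by exact_mod_cast hK
  unfold priorWeight
  rw [← Finset.mul_sum, h]
  field_simp

theorem state_weight_pos (S : Scenario net) (I : RunInput net) (t : ℕ) (k : V) :
    ∀ m ∈ Finset.Icc 1 (numExperts I.T), 0 < (state S I t k).weight m := by
  have h1 : ∀ m ∈ Finset.Icc 1 (numExperts I.T), 0 < (firstState I k).weight m :=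
    fun m hm => priorWeight_pos (one_le_numExperts _) (Finset.mem_Icc.mp hm).1
  induction t with
  | zero => exact h1
  | succ t ih =>
    rcases Nat.eq_zero_or_pos t with rfl | ht
    · exact h1
    · rw [state_succ S I ht]
      intro m hm
      exact div_pos (mul_pos (ih m hm) (Real.exp_pos _))
        (Finset.sum_pos (fun m' hm' => mul_pos (ih m' hm') (Real.exp_pos _)) ⟨m, hm⟩)

theorem sum_state_weight (S : Scenario net) (I : RunInput net) (t : ℕ) (k : V) :
    ∑ m ∈ Finset.Icc 1 (numExperts I.T), (state S I t k).weight m = 1 := by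
  have h1 : ∑ m ∈ Finset.Icc 1 (numExperts I.T), (firstState I k).weight m = 1 :=
    sum_priorWeight (one_le_numExperts _)
  rcases t with _ | t
  · exact h1
  · rcases Nat.eq_zero_or_pos t with rfl | ht
    · exact h1
    · rw [state_succ S I ht]
      simp only [nextState]
      rw [← Finset.sum_div]
      refine div_self (Finset.sum_pos (fun m hm =>
        mul_pos (state_weight_pos S I t k m hm) (Real.exp_pos _)) ?_).ne'
      exact ⟨1, Finset.mem_Icc.mpr ⟨le_rfl, one_le_numExperts _⟩⟩

theorem state_expert_mem (hI : Admissible S I) {t : ℕ} (ht : 1 ≤ t) (k : V) (m : ℕ) :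
    (state S I t k).expert m ∈ (1 - net.xi k (I.p k) t) • S.action k := by
  induction t, ht using Nat.le_induction with
  | base => exact hI.start_mem k
  | succ t ht _ =>
    rw [state_succ S I ht]
    exact (proj_spec (S.shrunk_nonempty k _) (S.shrunk_closed k _) (S.shrunk_convex k _) _).1

theorem combine_mem (hI : Admissible S I) {t : ℕ} (ht : 1 ≤ t) (k : V) :
    combine I k (state S I t k) ∈ (1 - net.xi k (I.p k) t) • S.action k :=
  (S.shrunk_convex k _).sum_mem (fun m hm => (state_weight_pos S I t k m hm).le)
    (sum_state_weight S I t k) fun m _ => state_expert_mem hI ht k m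

theorem Admissible.xi_eq (hI : Admissible S I) (k : V) (t : ℕ) :
    net.xi k (I.p k) t = net.smooth k (I.p k) / net.r k / quart t := by
  unfold Network.xi
  rw [net.delta_eq k (hI.p_nonneg k)]
  field_simp

theorem Admissible.xi_nonneg (hI : Admissible S I) (k : V) (t : ℕ) :
    0 ≤ net.xi k (I.p k) t := by
  rw [hI.xi_eq]
  have := net.smooth_nonneg k (hI.p_nonneg k)
  have := net.r_pos k
  have := quart_nonneg t
  positivity

theorem Admissible.xi_succ_le (hI : Admissible S I) (k : V) {t : ℕ} (ht : 1 ≤ t) :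
    net.xi k (I.p k) (t + 1) ≤ net.xi k (I.p k) t := by
  rw [hI.xi_eq, hI.xi_eq]
  have := net.smooth_nonneg k (hI.p_nonneg k)
  have := net.r_pos k
  have := quart_pos ht
  have := quart_mono (Nat.le_succ t)
  gcongr

theorem Admissible.delta_le (hI : Admissible S I) (k : V) (t : ℕ) :
    net.delta k (I.p k) t ≤ net.smoothTop k * (quart I.T / quart t) := by
  have h := net.smooth_le_smoothTop k (hI.p_nonneg k) hI.one_le_horizon (hI.p_le k)
  rw [net.delta_eq k (hI.p_nonneg k), ← mul_div_assoc]
  have := quart_nonneg t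
  gcongr

theorem Admissible.delta_nonneg (hI : Admissible S I) (k : V) (t : ℕ) :
    0 ≤ net.delta k (I.p k) t := by
  rw [net.delta_eq k (hI.p_nonneg k)]
  exact div_nonneg (net.smooth_nonneg k (hI.p_nonneg k)) (quart_nonneg t)

theorem Admissible.one_le_ratio {t T : ℕ} (ht : t ∈ Finset.Icc 1 T) :
    1 ≤ quart T / quart t := by
  obtain ⟨h1, h2⟩ := Finset.mem_Icc.mp ht
  rw [one_le_div (quart_pos h1)]
  exact quart_mono h2

/-- The scalar `a` is left free so that the bound covers both the decision set of round `t` and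
comparators shrunk by the parameter of round `t + 1`. The extra `δ` leaves room for the
perturbation. -/
theorem Admissible.norm_smul_add_le (hI : Admissible S I) {k : V} {t : ℕ}
    (ht : t ∈ Finset.Icc 1 I.T) {a : ℝ} (ha : |a| ≤ 1 + net.xi k (I.p k) t)
    {x : Alloc net.graph k} (hx : x ∈ a • S.action k) :
    ‖x‖ + net.delta k (I.p k) t ≤ net.reach k * (quart I.T / quart t) := by
  obtain ⟨y, hy, rfl⟩ := hx
  have hr := net.r_pos k
  have h1 := Admissible.one_le_ratio ht
  have h2 := hI.delta_le k t
  have h3 := hI.delta_nonneg k t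
  have hM := net.outer_pos k
  have h4 : ‖a • y‖ ≤ (1 + net.xi k (I.p k) t) * net.outer k := by
    rw [norm_smul]
    exact mul_le_mul ha (S.norm_le_outer hy) (norm_nonneg _)
      (by linarith [hI.xi_nonneg k t])
  unfold Network.xi at h4
  unfold Network.reach
  have h5 : (net.outer k / net.r k + 1) * net.delta k (I.p k) t ≤
      (net.outer k / net.r k + 1) * (net.smoothTop k * (quart I.T / quart t)) := by gcongr
  have h6 : net.outer k * 1 ≤ net.outer k * (quart I.T / quart t) := by gcongr
  have e : (1 + net.delta k (I.p k) t / net.r k) * net.outer k =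
      net.outer k + net.outer k / net.r k * net.delta k (I.p k) t := by field_simp
  simp only at h4 ⊢
  linarith

theorem Admissible.abs_one_sub_xi_le (hI : Admissible S I) (k : V) (t : ℕ) :
    |1 - net.xi k (I.p k) t| ≤ 1 + net.xi k (I.p k) t := by
  have := hI.xi_nonneg k t
  rw [abs_le]
  constructor <;> linarith

theorem norm_expert_le (hI : Admissible S I) {t : ℕ} (ht : t ∈ Finset.Icc 1 I.T) (k : V) (m : ℕ) :
    ‖(state S I t k).expert m‖ ≤ net.reach k * (quart I.T / quart t) := by
  have := hI.norm_smul_add_le ht (hI.abs_one_sub_xi_le k t)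
    (state_expert_mem hI (Finset.mem_Icc.mp ht).1 k m)
  linarith [hI.delta_nonneg k t]

theorem norm_combine_le (hI : Admissible S I) {t : ℕ} (ht : t ∈ Finset.Icc 1 I.T) (k : V) :
    ‖combine I k (state S I t k)‖ ≤ net.reach k * (quart I.T / quart t) := by
  have := hI.norm_smul_add_le ht (hI.abs_one_sub_xi_le k t)
    (combine_mem hI (Finset.mem_Icc.mp ht).1 k)
  linarith [hI.delta_nonneg k t]

theorem norm_perturb_le (hI : Admissible S I) {t : ℕ} (ht : t ∈ Finset.Icc 1 I.T) (k : V) :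
    ‖perturb I t k (state S I t k)‖ ≤ net.reach k * (quart I.T / quart t) := by
  have := hI.norm_smul_add_le ht (hI.abs_one_sub_xi_le k t)
    (combine_mem hI (Finset.mem_Icc.mp ht).1 k)
  refine (norm_add_le _ _).trans ?_
  rw [norm_smul, hI.norm_dir, mul_one, Real.norm_eq_abs, abs_of_nonneg (hI.delta_nonneg k t)]
  exact this

theorem abs_roundLoss_le (hI : Admissible S I) {t : ℕ} (ht : t ∈ Finset.Icc 1 I.T) {k : V}
    {x : Alloc net.graph k} (hx : ‖x‖ ≤ net.reach k * (quart I.T / quart t)) :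
    |roundLoss S I k t x| ≤ net.lossBound * (quart I.T / quart t) := by
  classical
  have h1 := Admissible.one_le_ratio ht
  unfold roundLoss lossFn
  rw [abs_of_nonneg (loss_nonneg _ _ _)]
  refine (loss_le net.minDemand_pos (fun j => S.demand_ge j t) _ k).trans ?_
  have hj : ∀ j, ‖Function.update (fun j => adjust (perturb I t j (state S I t j)) (I.gen j t))
      k x j‖ ≤ net.reach j * (quart I.T / quart t) := by
    intro j
    by_cases hjk : j = k
    · subst hjk; simpa using hx
    · rw [Function.update_of_ne hjk]
      exact (norm_adjust_le _ (hI.gen_nonneg j t)).trans (norm_perturb_le hI ht j)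
  have hL := net.lip_pos
  have h2 : 1 / net.minDemand * ∑ j, ‖Function.update
      (fun j => adjust (perturb I t j (state S I t j)) (I.gen j t)) k x j‖ ≤
      net.lip * ∑ j, net.reach j * (quart I.T / quart t) := by
    unfold Network.lip
    have := net.minDemand_pos
    gcongr with j
    exact hj j
  rw [← Finset.sum_mul] at h2
  -- One copy of this term is slack; it accounts for the factor 2 in `lossBound`.
  have h3 : 0 ≤ net.lip * (∑ j, net.reach j) * (quart I.T / quart t) := by
    have : 0 ≤ ∑ k, net.reach k := Finset.sum_nonneg fun k _ => (net.reach_pos k).le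
    positivity
  simp only [Network.lossBound]
  refine (add_le_add h1 (h2.trans (le_add_of_nonneg_right h3))).trans (le_of_eq ?_)
  ring

theorem abs_roundLoss_sub_le (S : Scenario net) (I : RunInput net) (k : V) (t : ℕ)
    (x x' : Alloc net.graph k) :
    |roundLoss S I k t x - roundLoss S I k t x'| ≤ net.lip * ‖x - x'‖ :=
  abs_loss_update_sub_le net.minDemand_pos (fun j => S.demand_ge j t) _ k x x'

theorem Network.gradBound_pos (net : Network V) {k : V} (hk : (nbhd net.graph k).Nonempty) :
    0 < net.gradBound k := by
  have := net.dim_pos k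
  have := net.lossBound_pos
  have := net.smooth_zero_pos k hk
  unfold Network.gradBound
  positivity

/-- The loss grows like `(T/t)^(1/4)` and `1/δ_t` like `t^(1/4)`, so the dependence on `t` cancels.
Bounding the smoothing constant below by its value at `p = 0` removes the dependence on `p`. -/
theorem norm_gradEst_le (hI : Admissible S I) {t : ℕ} (ht : t ∈ Finset.Icc 1 I.T) {k : V}
    (hk : (nbhd net.graph k).Nonempty) :
    ‖gradEst S I t (state S I t) k‖ ≤ net.gradBound k * quart I.T := by
  have hq := quart_pos (Finset.mem_Icc.mp ht).1
  have hs := net.smooth_zero_pos k hk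
  have hs' := net.smooth_zero_le k (hI.p_nonneg k)
  have hn := net.dim_pos k
  have hF := net.lossBound_pos
  have hT := quart_nonneg I.T
  have h := abs_roundLoss_le hI ht (norm_perturb_le hI ht k)
  unfold roundLoss at h
  unfold gradEst
  have hδ := hI.delta_nonneg k t
  rw [norm_smul, hI.norm_dir, mul_one, Real.norm_eq_abs, abs_mul,
    abs_of_nonneg (by positivity)]
  calc _ ≤ net.dim k / net.delta k (I.p k) t * (net.lossBound * (quart I.T / quart t)) := by
        gcongr
    _ = net.dim k * net.lossBound / net.smooth k (I.p k) * quart I.T := by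
        rw [net.delta_eq k (hI.p_nonneg k)]
        field_simp
    _ ≤ _ := by
        unfold Network.gradBound
        gcongr

end Run

/-! ### The grid of step sizes and the prior weights. -/

section Experts

theorem pathLength_nonneg {E : Type*} [NormedAddCommGroup E] (T : ℕ) (v : ℕ → E) :
    0 ≤ pathLength T v := Finset.sum_nonneg fun _ _ => norm_nonneg _

theorem half_logb_two_le {T : ℕ} (hT : 1 ≤ T) :
    (1 / 2 : ℝ) * Real.logb 2 (1 + T) ≤ 1 + Real.log T := by
  have hT' : (1 : ℝ) ≤ T := by exact_mod_cast hT
  have h2 := Real.log_two_gt_d9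
  have hlT : 0 ≤ Real.log T := Real.log_nonneg hT'
  have h : Real.log (1 + T) ≤ Real.log 2 + Real.log T := by
    rw [← Real.log_mul (by norm_num) (by positivity)]
    exact Real.log_le_log (by positivity) (by linarith)
  rw [Real.logb, ← mul_div_assoc, div_le_iff₀ (by linarith)]
  nlinarith

theorem numExperts_le {T : ℕ} (hT : 1 ≤ T) : (numExperts T : ℝ) ≤ 3 * (1 + Real.log T) := by
  have hT' : (1 : ℝ) ≤ T := by exact_mod_cast hT
  have hlT : 0 ≤ Real.log T := Real.log_nonneg hT'
  have h := half_logb_two_le hT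
  have h0 : 0 ≤ (1 / 2 : ℝ) * Real.logb 2 (1 + T) := by
    have := Real.logb_nonneg (b := 2) (by norm_num) (show (1 : ℝ) ≤ 1 + T by linarith)
    positivity
  have := Nat.ceil_lt_add_one h0
  unfold numExperts
  push_cast
  linarith

theorem sqrt_le_two_pow_numExperts (T : ℕ) :
    Real.sqrt (1 + T) ≤ 2 ^ (numExperts T - 1) := by
  unfold numExperts
  rw [Nat.add_sub_cancel, ← Real.rpow_natCast]
  calc Real.sqrt (1 + T) = (2 : ℝ) ^ ((1 / 2 : ℝ) * Real.logb 2 (1 + T)) := by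
        rw [mul_comm, Real.rpow_mul (by norm_num), Real.rpow_logb (by norm_num) (by norm_num)
          (by positivity), Real.sqrt_eq_rpow]
    _ ≤ _ := Real.rpow_le_rpow_of_exponent_le (by norm_num) (Nat.le_ceil _)

/-- The step sizes of the experts cover the optimal one up to a constant factor. -/
theorem exists_expert {R P : ℝ} (hR : 0 ≤ R) {T : ℕ} (hP : 0 ≤ P) (hPT : P ≤ 2 * R * T) :
    ∃ m ∈ Finset.Icc 1 (numExperts T), (2 : ℝ) ^ (m - 1) ≤ Real.sqrt (1 + P) ∧
      Real.sqrt (1 + P) ≤ 2 * Real.sqrt (1 + 2 * R) * 2 ^ (m - 1) := by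
  classical
  set B := Real.sqrt (1 + P) with hB
  have hB1 : 1 ≤ B := by rw [hB, Real.one_le_sqrt]; linarith
  have hc1 : 1 ≤ Real.sqrt (1 + 2 * R) := by rw [Real.one_le_sqrt]; linarith
  have hK := one_le_numExperts T
  -- The largest power of 2 below `√(1+P)` on the grid; the expert is `n + 1` because step sizes
  -- carry `2 ^ (m - 1)`. If the grid ends first, its last power still dominates `√(1+T)`, and `P ≤
  -- 2RT` costs only the factor `√(1+2R)`.
  set n := Nat.findGreatest (fun n => (2 : ℝ) ^ n ≤ B) (numExperts T - 1) with hn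
  have hnle : n ≤ numExperts T - 1 := Nat.findGreatest_le _
  have hn2 : (2 : ℝ) ^ n ≤ B :=
    Nat.findGreatest_spec (P := fun n => (2 : ℝ) ^ n ≤ B) (Nat.zero_le _) (by simpa using hB1)
  refine ⟨n + 1, Finset.mem_Icc.mpr ⟨by omega, by omega⟩, by simpa using hn2, ?_⟩
  rw [Nat.add_sub_cancel]
  rcases hnle.lt_or_eq with hlt | heq
  · have h := Nat.findGreatest_is_greatest (P := fun n => (2 : ℝ) ^ n ≤ B)
      (Nat.lt_succ_self n) hlt
    simp only [not_le, pow_succ] at h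
    calc B ≤ 2 * 1 * 2 ^ n := by linarith
      _ ≤ _ := by gcongr
  · have h := sqrt_le_two_pow_numExperts T
    rw [← heq] at h
    calc B ≤ Real.sqrt ((1 + 2 * R) * (1 + T)) := by
          apply Real.sqrt_le_sqrt
          have : 0 ≤ R * T := by positivity
          have : (0 : ℝ) ≤ T := by positivity
          linarith
      _ = 1 * Real.sqrt (1 + 2 * R) * Real.sqrt (1 + T) := by
          rw [Real.sqrt_mul (by linarith), one_mul]
      _ ≤ _ := by gcongr; norm_num

/-- Each prior weight is at least `1/K²`. The crude `log K ≤ K` suffices, since `K` is itself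
logarithmic in `T`. -/
theorem log_inv_priorWeight_le {T m : ℕ} (hT : 1 ≤ T) (hm : m ∈ Finset.Icc 1 (numExperts T)) :
    Real.log (1 / priorWeight (numExperts T) m) ≤ 6 * (1 + Real.log T) := by
  obtain ⟨hm1, hmK⟩ := Finset.mem_Icc.mp hm
  have hKle := numExperts_le hT
  set K := numExperts T
  have hm' : (1 : ℝ) ≤ m := by exact_mod_cast hm1
  have hmK' : (m : ℝ) ≤ K := by exact_mod_cast hmK
  have hK' : (1 : ℝ) ≤ K := hm'.trans hmK'
  have hw := priorWeight_pos (hm1.trans hmK) hm1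
  have h1 : 1 / priorWeight K m ≤ (K : ℝ) ^ 2 := by
    unfold priorWeight
    rw [one_div, mul_one_div, inv_div, div_le_iff₀ (by positivity)]
    have e : (K : ℝ) ^ 2 * ((K + 1) / K) = K * (K + 1) := by field_simp
    rw [e]
    gcongr
  calc _ ≤ Real.log ((K : ℝ) ^ 2) := Real.log_le_log (by positivity) h1
    _ = 2 * Real.log K := by rw [Real.log_pow]; norm_num
    _ ≤ 2 * K := by
        have := Real.log_le_sub_one_of_pos (show (0 : ℝ) < K by linarith)
        linarith
    _ ≤ _ := by linarith

end Experts

/-! ### The pathwise regret decomposition. -/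

section Regret

variable {V : Type*} [Fintype V] {net : Network V} {S : Scenario net} {I : RunInput net}

/-- The comparator `v t`, shrunk into the decision set of round `t + 1`. -/
noncomputable def shrunk (I : RunInput net) (k : V) (v : ℕ → Alloc net.graph k) (t : ℕ) : Alloc net.graph k :=
  (1 - net.xi k (I.p k) (t + 1)) • v t

/-- The amount by which the estimated gradient at the combined point fails the subgradient
inequality at the shrunk comparator. -/
noncomputable def subgradientGap (S : Scenario net) (I : RunInput net) (k : V)
    (v : ℕ → Alloc net.graph k) (t : ℕ) : ℝ :=
  roundLoss S I k t (combine I k (state S I t k)) - roundLoss S I k t (shrunk I k v t) -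
    inner ℝ (gradEst S I t (state S I t) k) (combine I k (state S I t k) - shrunk I k v t)

/-- The constant factor of the step sizes. -/
noncomputable def Network.stepConst (net : Network V) (k : V) : ℝ :=
  Real.sqrt (2 * net.R k ^ 3 / (2 * net.deg k * net.F k * net.lipTilde k))

theorem Network.stepConst_pos (net : Network V) {k : V} (hk : (nbhd net.graph k).Nonempty) :
    0 < net.stepConst k := by
  have := net.R_pos k
  have := net.deg_pos k hk
  have := net.F_pos k
  have := net.lipTilde_pos k
  unfold Network.stepConst
  positivity

theorem Network.eta_eq (net : Network V) (k : V) (m t : ℕ) :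
    net.eta k m t = net.stepConst k * 2 ^ (m - 1) / quart t ^ 3 := by
  unfold Network.eta Network.stepConst
  rw [rpow_neg_three_quarters]
  ring

/-- A bound of the sizes of the decision sets and their variation. -/
noncomputable def Network.span (net : Network V) (k : V) : ℝ :=
  net.reach k + 1 + net.smoothTop k / net.r k

theorem Network.reach_le_span (net : Network V) (k : V) : net.reach k ≤ net.span k := by
  have := div_nonneg (net.smoothTop_nonneg k) (net.r_pos k).le
  unfold Network.span
  linarith

theorem Admissible.norm_shrunk_le (hI : Admissible S I) {k : V} {v : ℕ → Alloc net.graph k} {t : ℕ}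
    (ht : t ∈ Finset.Icc 1 I.T) (hv : v t ∈ S.action k) :
    ‖shrunk I k v t‖ ≤ net.reach k * (quart I.T / quart t) := by
  have h := hI.norm_smul_add_le (a := 1 - net.xi k (I.p k) (t + 1)) ht
    ((hI.abs_one_sub_xi_le k (t + 1)).trans
      (by linarith [hI.xi_succ_le k (Finset.mem_Icc.mp ht).1]))
    (Set.smul_mem_smul_set hv)
  unfold shrunk
  linarith [hI.delta_nonneg k t]

/-- The difference is `(1 - ξ_{t+1})(v_t - v_{t-1}) + (ξ_t - ξ_{t+1}) v_{t-1}`: movement of the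
comparator plus drift of the shrinkage, the latter of order `T^(1/4) / t^(5/4)`. -/
theorem Admissible.norm_shrunk_sub_le (hI : Admissible S I) {k : V} {v : ℕ → Alloc net.graph k}
    (hv : ∀ t ∈ Finset.Icc 1 I.T, v t ∈ S.action k) {t : ℕ} (ht : t ∈ Finset.Icc 2 I.T) :
    ‖shrunk I k v t - shrunk I k v (t - 1)‖ ≤
      net.span k * (quart I.T / quart t) * ‖v t - v (t - 1)‖ +
        net.span k * (quart I.T / quart t ^ 5) := by
  obtain ⟨ht2, htT⟩ := Finset.mem_Icc.mp ht
  obtain ⟨s, rfl⟩ : ∃ s, t = s + 1 := ⟨t - 1, by omega⟩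
  rw [Nat.add_sub_cancel]
  have hq := quart_pos (show 1 ≤ s + 1 by omega)
  have ht1 : s + 1 ∈ Finset.Icc 1 I.T := Finset.mem_Icc.mpr ⟨by omega, htT⟩
  have hρ := Admissible.one_le_ratio ht1
  have hT0 := quart_nonneg I.T
  have hr := net.r_pos k
  have hM := net.outer_pos k
  have hst := net.smoothTop_nonneg k
  have hstr := div_nonneg hst hr.le
  have hreach := net.reach_pos k
  have e : shrunk I k v (s + 1) - shrunk I k v s =
      (1 - net.xi k (I.p k) (s + 1 + 1)) • (v (s + 1) - v s) +
        (net.xi k (I.p k) (s + 1) - net.xi k (I.p k) (s + 1 + 1)) • v s := by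
    unfold shrunk
    module
  have hxile := hI.xi_succ_le k (show 1 ≤ s + 1 by omega)
  have h1 : ‖(1 - net.xi k (I.p k) (s + 1 + 1)) • (v (s + 1) - v s)‖ ≤
      net.span k * (quart I.T / quart (s + 1)) * ‖v (s + 1) - v s‖ := by
    rw [norm_smul, Real.norm_eq_abs]
    refine mul_le_mul_of_nonneg_right ?_ (norm_nonneg _)
    have h := (hI.abs_one_sub_xi_le k (s + 1 + 1)).trans (add_le_add_right hxile 1)
    have hx : net.xi k (I.p k) (s + 1) ≤
        net.smoothTop k / net.r k * (quart I.T / quart (s + 1)) := by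
      unfold Network.xi
      rw [div_mul_eq_mul_div]
      gcongr
      exact hI.delta_le k (s + 1)
    have : 0 ≤ net.reach k * (quart I.T / quart (s + 1)) := by positivity
    unfold Network.span
    linarith
  have h2 : ‖(net.xi k (I.p k) (s + 1) - net.xi k (I.p k) (s + 1 + 1)) • v s‖ ≤
      net.span k * (quart I.T / quart (s + 1) ^ 5) := by
    rw [norm_smul, Real.norm_eq_abs, abs_of_nonneg (by linarith)]
    have hvs := S.norm_le_outer (hv s (Finset.mem_Icc.mpr ⟨by omega, by omega⟩))
    have hs := net.smooth_nonneg k (hI.p_nonneg k)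
    have hx : net.xi k (I.p k) (s + 1) - net.xi k (I.p k) (s + 1 + 1) ≤
        net.smoothTop k * quart I.T / net.r k * (1 / quart (s + 1) ^ 5) := by
      rw [hI.xi_eq, hI.xi_eq, div_eq_mul_one_div _ (quart (s + 1)),
        div_eq_mul_one_div _ (quart (s + 1 + 1)), ← mul_sub]
      refine mul_le_mul ?_ (inv_quart_sub_le (by omega)) ?_ (by positivity)
      · have := net.smooth_le_smoothTop k (hI.p_nonneg k) hI.one_le_horizon (hI.p_le k)
        gcongr
      · rw [sub_nonneg]
        exact one_div_le_one_div_of_le hq (quart_mono (Nat.le_succ _))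
    calc _ ≤ net.smoothTop k * quart I.T / net.r k * (1 / quart (s + 1) ^ 5) * net.outer k :=
          mul_le_mul hx hvs (norm_nonneg _) (by positivity)
      _ = (net.outer k / net.r k * net.smoothTop k) * (quart I.T / quart (s + 1) ^ 5) := by
          field_simp
      _ ≤ _ := by
          gcongr
          unfold Network.span Network.reach
          linarith
  rw [e]
  exact (norm_add_le _ _).trans (add_le_add h1 h2)

/-- Since `t ≤ T`, one has `t^(-1/4) ≤ T^(1/2) t^(-3/4)`, which reduces the sum to
`sum_inv_quart_cube_le`. -/
theorem Admissible.sum_delta_le (hI : Admissible S I) {k : V} {P : ℝ} (hP : I.p k ≤ P) :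
    ∑ t ∈ Finset.Icc 1 I.T, net.delta k (I.p k) t ≤
      4 * net.smoothPath k * (quart I.T ^ 3 * Real.sqrt (1 + P)) := by
  have hs := net.smooth_le_smoothPath k (hI.p_nonneg k) hP
  have hs0 := net.smooth_nonneg k (hI.p_nonneg k)
  have hT0 := quart_nonneg I.T
  have hterm : ∀ t ∈ Finset.Icc 1 I.T, net.delta k (I.p k) t ≤
      net.smooth k (I.p k) * quart I.T ^ 2 * (1 / quart t ^ 3) := by
    intro t ht
    have hq := quart_pos (Finset.mem_Icc.mp ht).1
    have hqT := quart_mono (Finset.mem_Icc.mp ht).2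
    have h2 : quart t ^ 2 ≤ quart I.T ^ 2 := by gcongr
    rw [net.delta_eq k (hI.p_nonneg k)]
    calc _ = net.smooth k (I.p k) * quart t ^ 2 * (1 / quart t ^ 3) := by field_simp
      _ ≤ _ := by gcongr
  refine (Finset.sum_le_sum hterm).trans ?_
  rw [← Finset.mul_sum]
  calc _ ≤ net.smooth k (I.p k) * quart I.T ^ 2 * (4 * quart I.T) := by
        gcongr; exact sum_inv_quart_cube_le _
    _ = net.smooth k (I.p k) * (4 * quart I.T ^ 3) := by ring
    _ ≤ net.smoothPath k * Real.sqrt (1 + P) * (4 * quart I.T ^ 3) := by gcongr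
    _ = _ := by ring

/-- Regret of the combined decisions against expert `m` on the surrogate losses. -/
theorem meta_regret_le (hI : Admissible S I) {k : V} (hk : (nbhd net.graph k).Nonempty)
    (hε : I.ε k = 1 / quart I.T ^ 3) {m : ℕ} (hm : m ∈ Finset.Icc 1 (numExperts I.T)) :
    ∑ t ∈ Finset.Icc 1 I.T, inner ℝ (gradEst S I t (state S I t) k)
        (combine I k (state S I t k) - (state S I t k).expert m) ≤
      6 * (1 + Real.log I.T) * quart I.T ^ 3 +
        8 * net.gradBound k ^ 2 * net.reach k ^ 2 * quart I.T ^ 3 := by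
  set τ := quart I.T with hτ
  have hτ0 : 0 < τ := quart_pos hI.one_le_horizon
  have hΓ := net.gradBound_pos hk
  have hD := net.reach_pos k
  have h := exponential_weights_regret (Finset.Icc 1 (numExperts I.T)) (T := I.T)
    (ε := I.ε k) (ω := fun t m => (state S I t k).weight m)
    (ℓ := fun t m => surrogate S I t (state S I t) k ((state S I t k).expert m))
    -- The gradient bound `Γ τ` times the distance bound `2 D τ / quart t`, with `τ = T^(1/4)`. The
    -- rate `1/τ³` balances the prior term against `∑ ε c²`.
    (c := fun t => 2 * net.gradBound k * net.reach k * τ ^ 2 / quart t)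
    (by rw [hε]; positivity) (fun t => state_weight_pos S I t k)
    (fun t => sum_state_weight S I t k)
    (fun t ht m => by rw [state_succ S I ht]; rfl)
    (fun t _ => by
      simp only [surrogate, ← inner_smul_right, ← inner_sum, smul_sub, Finset.sum_sub_distrib,
        ← Finset.sum_smul, sum_state_weight, one_smul]
      rw [show (∑ m ∈ Finset.Icc 1 (numExperts I.T),
        (state S I t k).weight m • (state S I t k).expert m) =
          combine I k (state S I t k) from rfl, sub_self, inner_zero_right])
    (fun t ht m _ => by
      have h1 := norm_gradEst_le hI ht hk
      have h2 := norm_expert_le hI ht k m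
      have h3 := norm_combine_le hI ht k
      have hq := quart_pos (Finset.mem_Icc.mp ht).1
      refine (abs_real_inner_le_norm _ _).trans ?_
      calc _ ≤ net.gradBound k * τ * (2 * (net.reach k * (τ / quart t))) := by
            refine mul_le_mul h1 ((norm_sub_le _ _).trans ?_) (norm_nonneg _) (by positivity)
            linarith
        _ = _ := by ring) hm
  have e : ∀ t, inner ℝ (gradEst S I t (state S I t) k)
      (combine I k (state S I t k) - (state S I t k).expert m) =
      -surrogate S I t (state S I t) k ((state S I t k).expert m) := by
    intro t
    rw [surrogate, ← inner_neg_right, neg_sub]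
  simp only [e, Finset.sum_neg_distrib]
  refine h.trans (add_le_add ?_ ?_)
  · rw [hε, div_div_eq_mul_div, div_one]
    refine mul_le_mul_of_nonneg_right ?_ (by positivity)
    exact log_inv_priorWeight_le hI.one_le_horizon hm
  · calc _ ≤ ∑ t ∈ Finset.Icc 1 I.T,
          2 * net.gradBound k ^ 2 * net.reach k ^ 2 * τ ^ 2 * (1 / quart t ^ 3) := by
          refine Finset.sum_le_sum fun t ht => ?_
          have hq := quart_pos (Finset.mem_Icc.mp ht).1
          have hqT : quart t ≤ τ := quart_mono (Finset.mem_Icc.mp ht).2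
          rw [hε]
          calc _ = 2 * net.gradBound k ^ 2 * net.reach k ^ 2 * τ * quart t *
                (1 / quart t ^ 3) := by field_simp
            _ ≤ 2 * net.gradBound k ^ 2 * net.reach k ^ 2 * τ * τ * (1 / quart t ^ 3) := by
                gcongr
            _ = _ := by ring
      _ ≤ 2 * net.gradBound k ^ 2 * net.reach k ^ 2 * τ ^ 2 * (4 * τ) := by
          rw [← Finset.mul_sum]
          gcongr
          exact sum_inv_quart_cube_le _
      _ = _ := by ring

/-- Regret of expert `m` on the linearized losses. -/
theorem expert_regret_le (hI : Admissible S I) {k : V} (hk : (nbhd net.graph k).Nonempty)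
    {v : ℕ → Alloc net.graph k} (hv : ∀ t ∈ Finset.Icc 1 I.T, v t ∈ S.action k) (m : ℕ) :
    ∑ t ∈ Finset.Icc 1 I.T, inner ℝ (gradEst S I t (state S I t) k)
        ((state S I t k).expert m - shrunk I k v t) ≤
      20 * net.span k ^ 2 * quart I.T ^ 3 * (1 + pathLength I.T v) /
          (net.stepConst k * 2 ^ (m - 1)) +
        2 * (net.stepConst k * 2 ^ (m - 1)) * net.gradBound k ^ 2 * quart I.T ^ 3 := by
  have hspan := net.reach_le_span k
  have hb := net.stepConst_pos hk
  have hle : ∀ t, net.reach k * (quart I.T / quart t) ≤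
      net.span k * (quart I.T / quart t) := fun t => by
    have := div_nonneg (quart_nonneg I.T) (quart_nonneg t)
    gcongr
  refine online_gradient_descent_regret hI.one_le_horizon (by positivity)
    ((net.reach_pos k).le.trans hspan) (fun t ht => ?_)
    (fun t ht => (norm_expert_le hI ht k m).trans (hle t))
    (fun t ht => (hI.norm_shrunk_le ht (hv t ht)).trans (hle t))
    (fun t ht => norm_gradEst_le hI ht hk) (fun t ht => hI.norm_shrunk_sub_le hv ht)
  -- The comparator was shrunk with the parameter of round `t + 1`, so it lies in the very set onto
  -- which this update projects, and the projection does not increase the distance to it.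
  rw [state_succ S I (Finset.mem_Icc.mp ht).1, ← net.eta_eq, ← updateDir_eq_gradEst hI]
  exact norm_proj_sub_le_of_mem (S.shrunk_nonempty k _) (S.shrunk_closed k _)
    (S.shrunk_convex k _) _ (Set.smul_mem_smul_set (hv t ht))

/-- The constant of the regret bound that holds along every run. -/
noncomputable def Network.regretConst (net : Network V) (k : V) : ℝ :=
  net.lip * (1 + net.outer k / net.r k) * (4 * net.smoothPath k) +
    20 * net.span k ^ 2 * (2 * Real.sqrt (1 + 2 * net.R k)) / net.stepConst k +
    2 * net.stepConst k * net.gradBound k ^ 2 + 6 + 8 * net.gradBound k ^ 2 * net.reach k ^ 2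

theorem Scenario.pathLength_le (S : Scenario net) {k : V} {v : ℕ → Alloc net.graph k} {T : ℕ}
    (hv : ∀ t ∈ Finset.Icc 1 T, v t ∈ S.action k) : pathLength T v ≤ 2 * net.R k * T := by
  have hR := net.R_pos k
  have h : ∀ t ∈ Finset.Icc 2 T, ‖v t - v (t - 1)‖ ≤ 2 * net.R k := by
    intro t ht
    obtain ⟨h2, hT⟩ := Finset.mem_Icc.mp ht
    have h1 := S.action_subset k (hv t (Finset.mem_Icc.mpr ⟨by omega, hT⟩))
    have h3 := S.action_subset k (hv (t - 1) (Finset.mem_Icc.mpr ⟨by omega, by omega⟩))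
    rw [Metric.mem_closedBall] at h1 h3
    rw [← dist_eq_norm]
    linarith [dist_triangle_right (v t) (v (t - 1)) (net.center k)]
  refine (Finset.sum_le_card_nsmul _ _ _ h).trans ?_
  rw [nsmul_eq_mul, mul_comm]
  gcongr
  simp only [Nat.card_Icc]
  omega

/-- Along every run, the dynamic regret is bounded up to the gaps of the gradient estimates. -/
theorem dynRegret_le (hI : Admissible S I) {k : V} (hk : (nbhd net.graph k).Nonempty)
    {v : ℕ → Alloc net.graph k} (hv : ∀ t ∈ Finset.Icc 1 I.T, v t ∈ S.action k)
    (hp : I.p k ≤ pathLength I.T v) (hε : I.ε k = 1 / quart I.T ^ 3) :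
    dynRegret S I k v ≤ ∑ t ∈ Finset.Icc 1 I.T, subgradientGap S I k v t +
      net.regretConst k * (1 + Real.log I.T) *
        (quart I.T ^ 3 * Real.sqrt (1 + pathLength I.T v)) := by
  have hP := pathLength_nonneg I.T v
  obtain ⟨m, hm, hm1, hm2⟩ := exists_expert (net.R_pos k).le hP (S.pathLength_le hv)
  have hmeta := meta_regret_le hI hk hε hm
  have hexp := expert_regret_le hI hk hv m
  have hδ := hI.sum_delta_le hp
  set P := pathLength I.T v with hPdef
  set B := Real.sqrt (1 + P) with hB
  set τ := quart I.T with hτ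
  have hB1 : 1 ≤ B := by rw [hB, Real.one_le_sqrt]; linarith
  have hB2 : 1 + P = B ^ 2 := (Real.sq_sqrt (by linarith)).symm
  have hτ0 : 0 < τ := quart_pos hI.one_le_horizon
  have hΓ := net.gradBound_pos hk
  have hb := net.stepConst_pos hk
  have hL := net.lip_pos
  have hr := net.r_pos k
  have hM := net.outer_pos k
  have hlog : 0 ≤ Real.log I.T := Real.log_nonneg (by exact_mod_cast hI.one_le_horizon)
  -- The path from `f(x_t)` to `f(v_t)` runs through the combined point and the shrunk comparator.
  -- The two end pieces cost `L δ` and `L ξ M`, with `M = outer`; the middle is the gap plus an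
  -- inner product split at expert `m`.
  have hround : ∀ t ∈ Finset.Icc 1 I.T,
      roundLoss S I k t (decision S I k t) - roundLoss S I k t (v t) ≤
      subgradientGap S I k v t + net.lip * (1 + net.outer k / net.r k) * net.delta k (I.p k) t +
      (inner ℝ (gradEst S I t (state S I t) k)
        (combine I k (state S I t k) - (state S I t k).expert m) +
      inner ℝ (gradEst S I t (state S I t) k)
        ((state S I t k).expert m - shrunk I k v t)) := by
    intro t ht
    have h1 := (abs_le.mp (abs_roundLoss_sub_le S I k t (decision S I k t)
      (combine I k (state S I t k)))).2
    have h2 := (abs_le.mp (abs_roundLoss_sub_le S I k t (shrunk I k v t) (v t))).2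
    have e1 : ‖decision S I k t - combine I k (state S I t k)‖ = net.delta k (I.p k) t := by
      rw [decision, perturb, add_sub_cancel_left, norm_smul, hI.norm_dir, mul_one,
        Real.norm_eq_abs, abs_of_nonneg (hI.delta_nonneg k t)]
    have e2 : ‖shrunk I k v t - v t‖ ≤ net.outer k / net.r k * net.delta k (I.p k) t := by
      have e : shrunk I k v t - v t = -(net.xi k (I.p k) (t + 1) • v t) := by
        unfold shrunk; module
      rw [e, norm_neg, norm_smul, Real.norm_eq_abs, abs_of_nonneg (hI.xi_nonneg k _)]
      calc _ ≤ net.xi k (I.p k) t * net.outer k :=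
            mul_le_mul (hI.xi_succ_le k (Finset.mem_Icc.mp ht).1) (S.norm_le_outer (hv t ht))
              (norm_nonneg _) (hI.xi_nonneg k t)
        _ = _ := by unfold Network.xi; ring
    rw [e1] at h1
    have h3 := mul_le_mul_of_nonneg_left e2 hL.le
    rw [← inner_add_right, sub_add_sub_cancel]
    unfold subgradientGap
    linarith
  unfold dynRegret
  rw [← Finset.sum_sub_distrib]
  refine (Finset.sum_le_sum hround).trans ?_
  rw [Finset.sum_add_distrib, Finset.sum_add_distrib, Finset.sum_add_distrib, ← Finset.mul_sum]
  have hA : net.lip * (1 + net.outer k / net.r k) * ∑ t ∈ Finset.Icc 1 I.T,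
      net.delta k (I.p k) t ≤
      net.lip * (1 + net.outer k / net.r k) * (4 * net.smoothPath k) * (τ ^ 3 * B) := by
    rw [mul_assoc (net.lip * _)]
    gcongr
  -- With `B = √(1+P)`, the quotient `B² / 2^(m-1)` is `O(B)` because `2^(m-1)` is not much smaller
  -- than `B`. The opposite comparison `2^(m-1) ≤ B` gives `hb2`.
  have hb1 : 20 * net.span k ^ 2 * τ ^ 3 * (1 + P) / (net.stepConst k * 2 ^ (m - 1)) ≤
      20 * net.span k ^ 2 * (2 * Real.sqrt (1 + 2 * net.R k)) / net.stepConst k *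
        (τ ^ 3 * B) := by
    rw [div_le_iff₀ (by positivity), hB2]
    calc 20 * net.span k ^ 2 * τ ^ 3 * B ^ 2 = 20 * net.span k ^ 2 * τ ^ 3 * B * B := by ring
      _ ≤ 20 * net.span k ^ 2 * τ ^ 3 * B *
          (2 * Real.sqrt (1 + 2 * net.R k) * 2 ^ (m - 1)) := by gcongr
      _ = _ := by field_simp
  have hb2 : 2 * (net.stepConst k * 2 ^ (m - 1)) * net.gradBound k ^ 2 * τ ^ 3 ≤
      2 * net.stepConst k * net.gradBound k ^ 2 * (τ ^ 3 * B) := by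
    calc _ = 2 * net.stepConst k * net.gradBound k ^ 2 * (τ ^ 3 * 2 ^ (m - 1)) := by ring
      _ ≤ _ := by gcongr
  have hc : 6 * (1 + Real.log I.T) * τ ^ 3 ≤ 6 * (1 + Real.log I.T) * (τ ^ 3 * B) := by
    have : τ ^ 3 * 1 ≤ τ ^ 3 * B := by gcongr
    gcongr
    linarith
  have hd : 8 * net.gradBound k ^ 2 * net.reach k ^ 2 * τ ^ 3 ≤
      8 * net.gradBound k ^ 2 * net.reach k ^ 2 * (τ ^ 3 * B) := by
    have : τ ^ 3 * 1 ≤ τ ^ 3 * B := by gcongr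
    gcongr
    linarith
  have hX : 0 ≤ (net.lip * (1 + net.outer k / net.r k) * (4 * net.smoothPath k) +
      20 * net.span k ^ 2 * (2 * Real.sqrt (1 + 2 * net.R k)) / net.stepConst k +
      2 * net.stepConst k * net.gradBound k ^ 2 +
      8 * net.gradBound k ^ 2 * net.reach k ^ 2) * Real.log I.T * (τ ^ 3 * B) := by
    have := net.smoothPath_nonneg k
    positivity
  unfold Network.regretConst
  linarith

end Regret

/-! ### Measurability of the run in its random inputs. -/

section Measurability

variable {V : Type*} [Fintype V] {Θ : Type*} [MeasurableSpace Θ]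

theorem Alloc.measurable_coord {Gr : SimpleGraph V} {i : V} {x : Θ → Alloc Gr i}
    (hx : Measurable x) (j : closedNbhd Gr i) : Measurable fun θ => x θ j :=
  (by fun_prop : Continuous fun y : Alloc Gr i => y j).measurable.comp hx

theorem measurable_constr {Gr : SimpleGraph V} {i : V} {x : Θ → Alloc Gr i} {d : Θ → ℝ}
    (hx : Measurable x) (hd : Measurable d) : Measurable fun θ => constr (x θ) (d θ) :=
  (Finset.measurable_fun_sum _ fun j _ => Alloc.measurable_coord hx j).sub hd

theorem measurable_adjust {Gr : SimpleGraph V} {i : V} {x : Θ → Alloc Gr i} {d : Θ → ℝ}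
    (hx : Measurable x) (hd : Measurable d) : Measurable fun θ => adjust (x θ) (d θ) := by
  have hs : Measurable fun θ => ∑ j, x θ j :=
    Finset.measurable_fun_sum _ fun j _ => Alloc.measurable_coord hx j
  exact Measurable.ite (measurableSet_lt hd hs) ((hd.div hs).smul hx) hx

theorem measurable_loss {Gr : SimpleGraph V} (l : V → ℝ) {y : Θ → ∀ k, Alloc Gr k}
    (hy : ∀ k, Measurable fun θ => y θ k) (i : V) : Measurable fun θ => loss l (y θ) i := by
  have ht : ∀ k j, Measurable fun θ => transfer (y θ) k j := by
    intro k j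
    unfold transfer
    split_ifs with h
    · exact Alloc.measurable_coord (hy k) _
    · exact measurable_const
  have hs : ∀ j, Measurable fun θ => satisfaction l (y θ) j := fun j =>
    ((Finset.measurable_fun_sum _ fun k _ => ht k j).div_const _).min measurable_const
  exact measurable_const.sub ((Finset.measurable_fun_sum _ fun j _ => hs j).const_mul _)

variable {net : Network V} (S : Scenario net) {T : ℕ} {ε p : V → ℝ} {d : V → ℕ → Θ → ℝ}
  {u : ∀ k, ℕ → Θ → Alloc net.graph k} {z₁ : ∀ k, Θ → Alloc net.graph k}

/-- The run with random generations, directions and starting points. -/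
def runInput (T : ℕ) (ε p : V → ℝ) (d : V → ℕ → Θ → ℝ) (u : ∀ k, ℕ → Θ → Alloc net.graph k)
    (z₁ : ∀ k, Θ → Alloc net.graph k) (θ : Θ) : RunInput net where
  T := T
  ε := ε
  p := p
  gen k t := d k t θ
  dir k t := u k t θ
  start k := z₁ k θ

/-- The components of the memory of every node are measurable. -/
structure MeasurableState (s : Θ → ∀ k, AgentState (Alloc net.graph k)) : Prop where
  expert : ∀ k m, Measurable fun θ => (s θ k).expert m
  weight : ∀ k m, Measurable fun θ => (s θ k).weight m
  dual : ∀ k, Measurable fun θ => (s θ k).dual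

variable {s : Θ → ∀ k, AgentState (Alloc net.graph k)}

theorem MeasurableState.combine (hs : MeasurableState s) (k : V) :
    Measurable fun θ => combine (runInput T ε p d u z₁ θ) k (s θ k) :=
  Finset.measurable_fun_sum (Finset.Icc 1 (numExperts T)) fun m _ =>
    (hs.weight k m).smul (hs.expert k m)

theorem MeasurableState.perturb (hs : MeasurableState s) (hu : ∀ k t, Measurable (u k t)) (k : V)
    (t : ℕ) : Measurable fun θ => perturb (runInput T ε p d u z₁ θ) t k (s θ k) :=
  (hs.combine k).add ((hu k t).const_smul (net.delta k (p k) t))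

theorem MeasurableState.lossFn (hs : MeasurableState s) (hd : ∀ k t, Measurable (d k t))
    (hu : ∀ k t, Measurable (u k t)) (k : V) (t : ℕ) {x : Θ → Alloc net.graph k}
    (hx : Measurable x) :
    Measurable fun θ => lossFn S (runInput T ε p d u z₁ θ) t (s θ) k (x θ) := by
  classical
  refine measurable_loss _ (fun j => ?_) k
  by_cases hj : j = k
  · subst hj
    simpa using hx
  · simp only [Function.update_of_ne hj]
    exact measurable_adjust (hs.perturb hu j t) (hd j t)

theorem MeasurableState.gradEst (hs : MeasurableState s) (hd : ∀ k t, Measurable (d k t))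
    (hu : ∀ k t, Measurable (u k t)) (k : V) (t : ℕ) :
    Measurable fun θ => gradEst S (runInput T ε p d u z₁ θ) t (s θ) k :=
  ((hs.lossFn S hd hu k t (hs.perturb hu k t)).const_mul
    (net.dim k / net.delta k (p k) t)).smul (hu k t)

theorem MeasurableState.nextState (hs : MeasurableState s) (hd : ∀ k t, Measurable (d k t))
    (hu : ∀ k t, Measurable (u k t)) (t : ℕ) :
    MeasurableState fun θ => nextState S (runInput T ε p d u z₁ θ) t (s θ) := by
  have hdual : ∀ k, Measurable fun θ => nextDual (runInput T ε p d u z₁ θ) t (s θ) k := fun k =>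
    measurable_const.max ((hs.dual k).add (((measurable_constr (measurable_adjust
      (hs.perturb hu k t) (hd k t)) (hd k t)).sub ((hs.dual k).const_mul _)).const_mul _))
  have hdir : ∀ k, Measurable fun θ => updateDir S (runInput T ε p d u z₁ θ) t (s θ) k := fun k =>
    (((hs.lossFn S hd hu k t (hs.perturb hu k t)).smul (hu k t)).add
      (((hdual k).mul (measurable_constr (hs.perturb hu k t) (hd k t))).smul
        (hu k t))).const_smul (net.dim k / net.delta k (p k) t)
  have hw : ∀ k m, Measurable fun θ => (s θ k).weight m *
      Real.exp (-ε k * surrogate S (runInput T ε p d u z₁ θ) t (s θ) k ((s θ k).expert m)) :=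
    fun k m => (hs.weight k m).mul (Real.measurable_exp.comp
      (((hs.gradEst S hd hu k t).inner ((hs.expert k m).sub (hs.combine k))).const_mul _))
  refine ⟨fun k m => ?_, fun k m => ?_, hdual⟩
  · exact (continuous_proj (S.shrunk_nonempty k (1 - net.xi k (p k) (t + 1)))
      (S.shrunk_closed k _) (S.shrunk_convex k _)).measurable.comp ((hs.expert k m).sub
        ((hdir k).const_smul (net.eta k m (t + 1))))
  · exact (hw k m).div (Finset.measurable_fun_sum (Finset.Icc 1 (numExperts T))
      fun m' _ => hw k m')

theorem measurableState_state (hd : ∀ k t, Measurable (d k t)) (hu : ∀ k t, Measurable (u k t))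
    (hz : ∀ k, Measurable (z₁ k)) (t : ℕ) :
    MeasurableState fun θ => state S (runInput T ε p d u z₁ θ) t := by
  have h1 : MeasurableState fun θ => firstState (runInput T ε p d u z₁ θ) :=
    ⟨fun k _ => hz k, fun _ m => (measurable_const : Measurable fun _ : Θ => priorWeight (numExperts T) m),
      fun _ => (measurable_const : Measurable fun _ : Θ => (0 : ℝ))⟩
  induction t with
  | zero => exact h1
  | succ t ih =>
    rcases Nat.eq_zero_or_pos t with rfl | ht
    · exact h1
    · simp only [state_succ S _ ht]
      exact ih.nextState S hd hu t

theorem measurable_roundLoss (hd : ∀ k t, Measurable (d k t)) (hu : ∀ k t, Measurable (u k t))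
    (hz : ∀ k, Measurable (z₁ k)) (k : V) (t : ℕ) {x : Θ → Alloc net.graph k}
    (hx : Measurable x) :
    Measurable fun θ => roundLoss S (runInput T ε p d u z₁ θ) k t (x θ) :=
  (measurableState_state S hd hu hz t).lossFn S hd hu k t hx

/-- The parameter space is arbitrary because the result is needed twice: over the sample space, and
over the product of one direction with all remaining data. -/
theorem measurable_subgradientGap (hd : ∀ k t, Measurable (d k t))
    (hu : ∀ k t, Measurable (u k t)) (hz : ∀ k, Measurable (z₁ k)) (k : V)
    (v : ℕ → Alloc net.graph k) (t : ℕ) :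
    Measurable fun θ => subgradientGap S (runInput T ε p d u z₁ θ) k v t := by
  have hs := measurableState_state (T := T) (ε := ε) (p := p) S hd hu hz t
  have hw : Measurable fun θ => shrunk (runInput T ε p d u z₁ θ) k v t :=
    (measurable_const : Measurable fun _ : Θ => (1 - net.xi k (p k) (t + 1)) • v t)
  exact ((measurable_roundLoss S hd hu hz k t (hs.combine k)).sub
    (measurable_roundLoss S hd hu hz k t hw)).sub
    ((hs.gradEst S hd hu k t).inner ((hs.combine k).sub hw))

end Measurability

/-! ### Dependence of a round on the sampled directions. -/

section Locality

variable {V : Type*} [Fintype V] {net : Network V} (S : Scenario net) (I : RunInput net)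

/-- The memory in round `t` depends only on the directions of the earlier rounds. -/
theorem state_congr_dir {dir : ∀ k, ℕ → Alloc net.graph k} {t : ℕ}
    (h : ∀ k, ∀ r < t, dir k r = I.dir k r) :
    state S { I with dir := dir } t = state S I t := by
  induction t with
  | zero => rfl
  | succ t ih =>
    rcases Nat.eq_zero_or_pos t with rfl | ht
    · rfl
    · rw [state_succ S _ ht, state_succ S _ ht, ih fun k r hr => h k r (by omega)]
      have hp : ∀ k s, perturb { I with dir := dir } t k s = perturb I t k s := by
        intro k s
        simp only [perturb, h k t (Nat.lt_succ_self t)]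
        rfl
      have hl : ∀ s k x, lossFn S { I with dir := dir } t s k x = lossFn S I t s k x := by
        intro s k x
        simp only [lossFn, hp]
      have hg : ∀ s k, gradEst S { I with dir := dir } t s k = gradEst S I t s k := by
        intro s k
        simp only [gradEst, hp, hl, h k t (Nat.lt_succ_self t)]
      have hq : ∀ s k, nextDual { I with dir := dir } t s k = nextDual I t s k := by
        intro s k
        simp only [nextDual, hp]
      have hd : ∀ s k, updateDir S { I with dir := dir } t s k = updateDir S I t s k := by
        intro s k
        simp only [updateDir, hp, hl, hq, h k t (Nat.lt_succ_self t)]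
      have hs : ∀ s k x, surrogate S { I with dir := dir } t s k x = surrogate S I t s k x := by
        intro s k x
        simp only [surrogate, hg]
        rfl
      funext k
      simp only [nextState, hd, hs, hq]

/-- Changing the direction of node `k` in round `t` changes only its own decision in that round. -/
theorem subgradientGap_congr_dir {dir : ∀ k, ℕ → Alloc net.graph k} {k : V} {t : ℕ}
    (h : ∀ j, ∀ r < t, dir j r = I.dir j r) (hk : ∀ j ≠ k, dir j t = I.dir j t)
    (v : ℕ → Alloc net.graph k) :
    subgradientGap S { I with dir := dir } k v t =
      roundLoss S I k t (combine I k (state S I t k)) - roundLoss S I k t (shrunk I k v t) -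
      inner ℝ ((net.dim k / net.delta k (I.p k) t * roundLoss S I k t
        (combine I k (state S I t k) + net.delta k (I.p k) t • dir k t)) • dir k t)
        (combine I k (state S I t k) - shrunk I k v t) := by
  classical
  have hst := state_congr_dir S I h
  -- The adjusted decision of `k` itself is overwritten by `x`, and the directions of the other
  -- nodes in round `t` are unchanged.
  have hl : ∀ x, lossFn S { I with dir := dir } t (state S I t) k x =
      lossFn S I t (state S I t) k x := by
    intro x
    unfold lossFn
    congr 1
    funext j
    by_cases hj : j = k
    · subst hj; simp
    · rw [Function.update_of_ne hj, Function.update_of_ne hj]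
      simp only [perturb, hk j hj]
      rfl
  simp only [subgradientGap, roundLoss, gradEst, hst, hl]
  rfl

end Locality

/-! ### Averaging the gap over one direction. -/

section Expectation

variable {V : Type*} [Fintype V]

theorem sphereInvariant_sphereUniform (Gr : SimpleGraph V) (k : V) :
    SphereInvariant (sphereUniform Gr k) := by
  intro e
  simp only [sphereUniform]
  rw [Measure.map_smul, map_sphereMap_toSphere]

variable {net : Network V} (S : Scenario net)

/-- Averaged over the direction of node `k` in round `t`, the gap is at most of the order of the
smoothing radius. -/
theorem integral_subgradientGap_le (I : RunInput net) (k : V) (v : ℕ → Alloc net.graph k) (t : ℕ)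
    (hδ : 0 < net.delta k (I.p k) t) [IsProbabilityMeasure (sphereUniform net.graph k)]
    (dir : Metric.sphere (0 : Alloc net.graph k) 1 → ∀ j, ℕ → Alloc net.graph j)
    (h : ∀ x, ∀ j, ∀ r < t, dir x j r = I.dir j r) (hk : ∀ x, ∀ j ≠ k, dir x j t = I.dir j t)
    (hx : ∀ x, dir x k t = x) :
    ∫ x, subgradientGap S { I with dir := dir x } k v t ∂(sphereUniform net.graph k) ≤
      2 * net.lip * net.delta k (I.p k) t := by
  obtain ⟨φ, h1, h2, h3⟩ := exists_separable_loss net.minDemand_pos (fun j => S.demand_ge j t)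
    (fun j => adjust (perturb I t j (state S I t j)) (I.gen j t)) k
  have hn := closedNbhd_card_pos (Gr := net.graph) k
  -- The coordinate functions have Lipschitz constant `L / n`, so the dimension factor in the
  -- estimate cancels.
  have hest := (sphereInvariant_sphereUniform net.graph k).one_point_estimate h1 h2
    (f := roundLoss S I k t) h3 hδ (combine I k (state S I t k)) (shrunk I k v t)
  simp only [subgradientGap_congr_dir S I (h _) (hk _), hx]
  rw [Fintype.card_coe] at hest
  refine hest.trans (le_of_eq ?_)
  unfold Network.lip
  field_simp

end Expectation

/-! ### Integrability and the expected gap. -/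

section MainEstimate

variable {V : Type*} [Fintype V] {net : Network V} {S : Scenario net}

theorem abs_subgradientGap_le {I : RunInput net} (hI : Admissible S I) {k : V}
    (hk : (nbhd net.graph k).Nonempty) {v : ℕ → Alloc net.graph k} {t : ℕ}
    (ht : t ∈ Finset.Icc 1 I.T) (hv : v t ∈ S.action k) :
    |subgradientGap S I k v t| ≤ 2 * (net.lossBound * (quart I.T / quart t)) +
      net.gradBound k * quart I.T * (2 * (net.reach k * (quart I.T / quart t))) := by
  have hz := norm_combine_le hI ht k
  have hw := hI.norm_shrunk_le ht hv
  have h1 := abs_roundLoss_le hI ht hz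
  have h2 := abs_roundLoss_le hI ht hw
  have h3 : |inner ℝ (gradEst S I t (state S I t) k)
      (combine I k (state S I t k) - shrunk I k v t)| ≤
      net.gradBound k * quart I.T * (2 * (net.reach k * (quart I.T / quart t))) := by
    refine (abs_real_inner_le_norm _ _).trans (mul_le_mul (norm_gradEst_le hI ht hk)
      ((norm_sub_le _ _).trans (by linarith)) (norm_nonneg _) ?_)
    exact mul_nonneg (net.gradBound_pos hk).le (quart_nonneg _)
  unfold subgradientGap
  have h4 := abs_sub (roundLoss S I k t (combine I k (state S I t k)) -
    roundLoss S I k t (shrunk I k v t)) (inner ℝ (gradEst S I t (state S I t) k)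
      (combine I k (state S I t k) - shrunk I k v t))
  have h5 := abs_sub (roundLoss S I k t (combine I k (state S I t k)))
    (roundLoss S I k t (shrunk I k v t))
  linarith

variable {T : ℕ} {ε p : V → ℝ} {Ω : Type*} [MeasurableSpace Ω] {P : Measure Ω}
  [IsProbabilityMeasure P] {d : V → ℕ → Ω → ℝ}
  {U : ∀ k, ℕ → Ω → Metric.sphere (0 : Alloc net.graph k) 1} {z₁ : ∀ k, Ω → Alloc net.graph k}

theorem integrable_subgradientGap {i : V} (hi : (nbhd net.graph i).Nonempty)
    {v : ℕ → Alloc net.graph i} {t : ℕ} (ht : t ∈ Finset.Icc 1 T) (hv : v t ∈ S.action i)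
    (hI : ∀ ω, Admissible S (runInput T ε p d (fun k t ω => (U k t ω : Alloc net.graph k)) z₁ ω))
    (hd : ∀ k t, Measurable (d k t)) (hz : ∀ k, Measurable (z₁ k))
    (hU : ∀ k t, Measurable (U k t)) :
    Integrable (fun ω => subgradientGap S
      (runInput T ε p d (fun k t ω => (U k t ω : Alloc net.graph k)) z₁ ω) i v t) P :=
  Integrable.of_bound (measurable_subgradientGap S hd (fun k t => (hU k t).subtype_val) hz i v
    t).aestronglyMeasurable
    (2 * (net.lossBound * (quart T / quart t)) +
      net.gradBound i * quart T * (2 * (net.reach i * (quart T / quart t))))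
    (.of_forall fun ω => abs_subgradientGap_le (hI ω) hi ht hv)

/-- With all randomness except the direction of node `i` in round `t` frozen, the state and the
other nodes' decisions of that round are fixed. The spherical average then applies, and independence
lifts it to the expectation. -/
theorem expectation_subgradientGap_le {i : V} (hi : (nbhd net.graph i).Nonempty)
    {v : ℕ → Alloc net.graph i} {t : ℕ} (ht : t ∈ Finset.Icc 1 T) (hv : v t ∈ S.action i)
    (hp : 0 ≤ p i)
    (hI : ∀ ω, Admissible S (runInput T ε p d (fun k t ω => (U k t ω : Alloc net.graph k)) z₁ ω))
    (hd : ∀ k t, Measurable (d k t)) (hz : ∀ k, Measurable (z₁ k))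
    (hU : ∀ k t, Measurable (U k t))
    (hlaw : P.map (U i t) = sphereUniform net.graph i)
    (hind : iIndepFun (fun (a : V × ℕ) ω => U a.1 a.2 ω) P)
    (hUZ : IndepFun (fun ω (a : V × ℕ) => U a.1 a.2 ω)
      (fun ω => ((fun (a : V × ℕ) => d a.1 a.2 ω), (fun k => z₁ k ω))) P) :
    ∫ ω, subgradientGap S
      (runInput T ε p d (fun k t ω => (U k t ω : Alloc net.graph k)) z₁ ω) i v t ∂P ≤
      2 * net.lip * net.delta i (p i) t := by
  classical
  obtain ⟨ω₀⟩ : Nonempty Ω := nonempty_of_isProbabilityMeasure P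
  have hδ : 0 < net.delta i (p i) t := by
    rw [net.delta_eq i hp]
    exact div_pos ((net.smooth_zero_pos i hi).trans_le (net.smooth_zero_le i hp))
      (quart_pos (Finset.mem_Icc.mp ht).1)
  -- The normalisation is read off from the assumed law, so the total surface measure need not be
  -- computed.
  have hprob : IsProbabilityMeasure (sphereUniform net.graph i) :=
    hlaw ▸ Measure.isProbabilityMeasure_map (hU i t).aemeasurable
  have hZm : Measurable fun ω => ((fun (a : V × ℕ) => d a.1 a.2 ω), (fun k => z₁ k ω)) :=
    (measurable_pi_lambda _ fun a : V × ℕ => hd a.1 a.2).prodMk (measurable_pi_lambda _ hz)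
  have hXY := indepFun_update_prod (U := fun (a : V × ℕ) => U a.1 a.2)
    (fun a : V × ℕ => hU a.1 a.2) hZm hind hUZ (i, t) (U i t ω₀)
  have hall : Measurable fun ω (a : V × ℕ) => U a.1 a.2 ω :=
    measurable_pi_lambda _ fun a : V × ℕ => hU a.1 a.2
  have hYm : Measurable fun ω => (Function.update (fun a : V × ℕ => U a.1 a.2 ω) (i, t)
      (U i t ω₀), ((fun (a : V × ℕ) => d a.1 a.2 ω), (fun k => z₁ k ω))) :=
    (measurable_update_left.comp hall).prodMk hZm
  let Code := (∀ a : V × ℕ, Metric.sphere (0 : Alloc net.graph a.1) 1) ×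
    ((V × ℕ → ℝ) × (∀ k, Alloc net.graph k))
  let dir : Metric.sphere (0 : Alloc net.graph i) 1 × Code →
      ∀ a : V × ℕ, Metric.sphere (0 : Alloc net.graph a.1) 1 :=
    fun θ => Function.update θ.2.1 (i, t) θ.1
  let h : Metric.sphere (0 : Alloc net.graph i) 1 × Code → ℝ := fun θ =>
    subgradientGap S (runInput T ε p (fun k t θ => θ.2.2.1 (k, t))
      (fun k t θ => (dir θ (k, t) : Alloc net.graph k)) (fun k θ => θ.2.2.2 k) θ) i v t
  have hdir : ∀ a, Measurable fun θ => dir θ a := by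
    intro a
    by_cases ha : a = (i, t)
    · subst ha
      simp only [dir, Function.update_self]
      exact measurable_fst
    · simp only [dir, Function.update_of_ne ha]
      exact (measurable_pi_apply a).comp (measurable_fst.comp measurable_snd)
  have hm : Measurable h := measurable_subgradientGap S
    (fun k t => (measurable_pi_apply (k, t)).comp
      (measurable_fst.comp (measurable_snd.comp measurable_snd)))
    (fun k t => (hdir (k, t)).subtype_val)
    (fun k => (measurable_pi_apply k).comp
      (measurable_snd.comp (measurable_snd.comp measurable_snd))) i v t
  have heq : ∀ ω, h (U i t ω, (Function.update (fun a : V × ℕ => U a.1 a.2 ω) (i, t)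
      (U i t ω₀), ((fun (a : V × ℕ) => d a.1 a.2 ω), (fun k => z₁ k ω)))) =
      subgradientGap S
        (runInput T ε p d (fun k t ω => (U k t ω : Alloc net.graph k)) z₁ ω) i v t := by
    intro ω
    simp only [h, dir, Function.update_idem, runInput]
    rw [Function.update_eq_self (i, t) fun a : V × ℕ => U a.1 a.2 ω]
  have hint := integrable_subgradientGap (P := P) hi ht hv hI hd hz hU
  simp only [← heq] at hint ⊢
  refine IndepFun.integral_le_of_forall_integral_le (hU i t) hYm hXY hm hint fun ω => ?_
  rw [hlaw]
  exact integral_subgradientGap_le S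
    (runInput T ε p d (fun k t ω => (U k t ω : Alloc net.graph k)) z₁ ω) i v t hδ
    (fun x j r => (Function.update (fun a : V × ℕ => U a.1 a.2 ω) (i, t) x (j, r) :
      Alloc net.graph j))
    (fun x j r hr => by
      rw [Function.update_of_ne (by simp only [ne_eq, Prod.mk.injEq]; omega)]; rfl)
    (fun x j hj => by rw [Function.update_of_ne (by simp [hj])]; rfl)
    (fun x => by rw [Function.update_self]) |>.trans' (le_of_eq (by
      congr 1
      funext x
      simp only [h, dir, Function.update_idem, runInput]))

theorem integrable_dynRegret {i : V} {v : ℕ → Alloc net.graph i}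
    (hv : ∀ t ∈ Finset.Icc 1 T, v t ∈ S.action i)
    (hI : ∀ ω, Admissible S (runInput T ε p d (fun k t ω => (U k t ω : Alloc net.graph k)) z₁ ω))
    (hd : ∀ k t, Measurable (d k t)) (hz : ∀ k, Measurable (z₁ k))
    (hU : ∀ k t, Measurable (U k t)) :
    Integrable (fun ω => dynRegret S
      (runInput T ε p d (fun k t ω => (U k t ω : Alloc net.graph k)) z₁ ω) i v) P := by
  have hu : ∀ k t, Measurable fun ω => (U k t ω : Alloc net.graph k) :=
    fun k t => (hU k t).subtype_val
  have hint : ∀ t ∈ Finset.Icc 1 T, ∀ x : Ω → Alloc net.graph i, Measurable x →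
      (∀ ω, ‖x ω‖ ≤ net.reach i * (quart T / quart t)) → Integrable (fun ω => roundLoss S
        (runInput T ε p d (fun k t ω => (U k t ω : Alloc net.graph k)) z₁ ω) i t (x ω)) P :=
    fun t ht x hx hxb => Integrable.of_bound
      (measurable_roundLoss S hd hu hz i t hx).aestronglyMeasurable
      (net.lossBound * (quart T / quart t)) (.of_forall fun ω => abs_roundLoss_le (hI ω) ht (hxb ω))
  refine Integrable.sub (integrable_finsetSum (Finset.Icc 1 T) fun t ht => ?_)
    (integrable_finsetSum (Finset.Icc 1 T) fun t ht => ?_)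
  · exact hint t ht _ ((measurableState_state S hd hu hz t).perturb hu i t)
      fun ω => norm_perturb_le (hI ω) ht i
  · refine hint t ht _ measurable_const fun ω => (S.norm_le_outer (hv t ht)).trans ?_
    have h1 := Admissible.one_le_ratio ht
    have hM := net.outer_pos i
    have hr := net.r_pos i
    have hs := net.smoothTop_nonneg i
    have h2 : net.outer i ≤ net.reach i := by
      unfold Network.reach
      have : 0 ≤ (net.outer i / net.r i + 1) * net.smoothTop i := by positivity
      linarith
    nlinarith

end MainEstimate

end ResourceSharing

/-! ### The expected regret bound. -/

theorem mainTheorem2 {V : Type*} [Fintype V] (net : ResourceSharing.Network V) (i : V)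
    (hi : (ResourceSharing.nbhd net.graph i).Nonempty) :
    ∃ (C : ℝ) (a : ℕ) (ε₀ : ℕ → ℝ), (∀ T, 1 ≤ T → 0 < ε₀ T) ∧
      ∀ (S : ResourceSharing.Scenario net) (T : ℕ), 1 ≤ T →
      ∀ (ε p : V → ℝ) (v : ∀ k, ℕ → ResourceSharing.Alloc net.graph k),
        ε i = ε₀ T →
        (∀ k, ∀ t ∈ Finset.Icc 1 T, v k t ∈ S.action k) →
        (∀ k, 0 ≤ p k ∧ p k ≤ ResourceSharing.pathLength T (v k)) →
      ∀ (Ω : Type*) [MeasurableSpace Ω] (P : MeasureTheory.Measure Ω)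
        [MeasureTheory.IsProbabilityMeasure P]
        (d : V → ℕ → Ω → ℝ)
        (U : ∀ k, ℕ → Ω → Metric.sphere (0 : ResourceSharing.Alloc net.graph k) 1)
        (z₁ : ∀ k, Ω → ResourceSharing.Alloc net.graph k),
        (∀ k t, Measurable (d k t)) →
        (∀ k t ω, 0 ≤ d k t ω) →
        (∀ k t ω, ∀ x ∈ S.action k, |ResourceSharing.constr x (d k t ω)| ≤ net.G k) →
        (∀ k, Measurable (z₁ k)) →
        (∀ k ω, z₁ k ω ∈ (1 - net.xi k (p k) 1) • S.action k) →
        (∀ k t, Measurable (U k t)) →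
        (∀ k t, P.map (U k t) = ResourceSharing.sphereUniform net.graph k) →
        ProbabilityTheory.iIndepFun (fun (a : V × ℕ) ω => U a.1 a.2 ω) P →
        ProbabilityTheory.IndepFun (fun ω (a : V × ℕ) => U a.1 a.2 ω)
          (fun ω => ((fun (a : V × ℕ) => d a.1 a.2 ω), (fun k => z₁ k ω))) P →
        let regret : Ω → ℝ := fun ω =>
          ResourceSharing.dynRegret S
            { T := T, ε := ε, p := p, gen := fun k t => d k t ω,
              dir := fun k t => (U k t ω : ResourceSharing.Alloc net.graph k),
              start := fun k => z₁ k ω } i (v i)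
        MeasureTheory.Integrable regret P ∧
        ∫ ω, regret ω ∂P ≤ C * (1 + Real.log T) ^ a *
          ((T : ℝ) ^ (3 / 4 : ℝ) *
            (1 + ResourceSharing.pathLength T (v i)) ^ (1 / 2 : ℝ)) := by
  classical
  -- The summand `8 L · smoothPath` pays for the expected gaps: `2 L ∑ δ_t` with `∑ δ_t ≤ 4 ·
  -- smoothPath · T^(3/4) √(1+P)`. A single power of the logarithm and the rate `T^(-3/4)` suffice.
  refine ⟨net.regretConst i + 8 * net.lip * net.smoothPath i, 1,
    fun T => 1 / ResourceSharing.quart T ^ 3,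
    fun T hT => by have := ResourceSharing.quart_pos hT; positivity, ?_⟩
  intro S T hT ε p v hε hv hp Ω _ P _ d U z₁ hd hd0 _ hz hz₁ hU hlaw hind hUZ regret
  have hI : ∀ ω, ResourceSharing.Admissible S (ResourceSharing.runInput T ε p d
      (fun k t ω => (U k t ω : ResourceSharing.Alloc net.graph k)) z₁ ω) := fun ω =>
    { one_le_horizon := hT
      p_nonneg := fun k => (hp k).1
      p_le := fun k => (hp k).2.trans (S.pathLength_le (hv k))
      gen_nonneg := fun k t => hd0 k t ω
      norm_dir := fun k t => by simp [ResourceSharing.runInput]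
      start_mem := fun k => hz₁ k ω }
  have hint : MeasureTheory.Integrable regret P :=
    ResourceSharing.integrable_dynRegret (hv i) hI hd hz hU
  refine ⟨hint, ?_⟩
  set B := Real.sqrt (1 + ResourceSharing.pathLength T (v i)) with hB
  set τ := ResourceSharing.quart T with hτ
  have hgap := fun t (ht : t ∈ Finset.Icc 1 T) =>
    ResourceSharing.integrable_subgradientGap (P := P) hi ht (hv i t ht) hI hd hz hU
  have hle : ∫ ω, regret ω ∂P ≤ ∑ t ∈ Finset.Icc 1 T, 2 * net.lip * net.delta i (p i) t +
      net.regretConst i * (1 + Real.log T) * (τ ^ 3 * B) := by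
    calc ∫ ω, regret ω ∂P
        ≤ ∫ ω, (∑ t ∈ Finset.Icc 1 T, ResourceSharing.subgradientGap S
            (ResourceSharing.runInput T ε p d
              (fun k t ω => (U k t ω : ResourceSharing.Alloc net.graph k)) z₁ ω) i (v i) t +
            net.regretConst i * (1 + Real.log T) * (τ ^ 3 * B)) ∂P :=
          MeasureTheory.integral_mono hint
            ((MeasureTheory.integrable_finsetSum _ hgap).add
              (MeasureTheory.integrable_const _))
            fun ω => ResourceSharing.dynRegret_le (hI ω) hi (hv i) (hp i).2 hε
      _ = ∑ t ∈ Finset.Icc 1 T, ∫ ω, ResourceSharing.subgradientGap S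
            (ResourceSharing.runInput T ε p d
              (fun k t ω => (U k t ω : ResourceSharing.Alloc net.graph k)) z₁ ω) i (v i) t ∂P +
            net.regretConst i * (1 + Real.log T) * (τ ^ 3 * B) := by
          rw [MeasureTheory.integral_add (MeasureTheory.integrable_finsetSum _ hgap)
            (MeasureTheory.integrable_const _), MeasureTheory.integral_finsetSum _ hgap]
          simp
      _ ≤ _ := by
          gcongr with t ht
          exact ResourceSharing.expectation_subgradientGap_le hi ht (hv i t ht) (hp i).1 hI hd hz
            hU (hlaw i t) hind hUZ
  -- The smoothing radii are deterministic, so their sum may be bounded along any one admissible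
  -- run.
  obtain ⟨ω₀⟩ : Nonempty Ω := MeasureTheory.nonempty_of_isProbabilityMeasure P
  have hδ : ∑ t ∈ Finset.Icc 1 T, net.delta i (p i) t ≤
      4 * net.smoothPath i * (τ ^ 3 * B) := (hI ω₀).sum_delta_le (k := i) (hp i).2
  rw [ResourceSharing.rpow_three_quarters, ← Real.sqrt_eq_rpow, pow_one]
  refine hle.trans ?_
  rw [← Finset.mul_sum]
  have hL := net.lip_pos
  have hs := net.smoothPath_nonneg i
  have hτ0 := ResourceSharing.quart_pos hT
  have hlog : 0 ≤ Real.log T := Real.log_nonneg (by exact_mod_cast hT)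
  have h1 : 2 * net.lip * ∑ t ∈ Finset.Icc 1 T, net.delta i (p i) t ≤
      2 * net.lip * (4 * net.smoothPath i * (τ ^ 3 * B)) := by gcongr
  have h2 : 0 ≤ 8 * net.lip * net.smoothPath i * Real.log T * (τ ^ 3 * B) := by positivity
  linarith
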